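/- Let $V$ and $W$ be complex vector spaces with a bilinear pairing $\mathbf p\colon V\otimes W\to\mathbb C$, and let $(v_b)_{b\in\mathcal B}$, $(w_b)_{b\in\mathcal B}$ be bases of $V$ and $W$ indexed by the same set with $\mathbf p(x,y)=\sum_{b}x(b)y(b)$ in coordinates; write $V_*:=W$. Assume $\dim V=\aleph_t$ with $t\in\mathbb N=\{0,1,2,\dots\}$. Let $\mathfrak{gl}^M$ be the Lie algebra of all linear operators $\varphi$ on $V$ whose dual $\varphi^*\colon V^*\to V^*$ maps $V_*\subset V^*$ into itself. Let $\mathfrak{gl}(V,V_*)\subset\mathfrak{gl}^M$ be the image of $V\otimes V_*$ under $v\otimes w\mapsto(u\mapsto\mathbf p(u,w)v)$, let $\mathfrak{sl}(V,V_*)$ be the image of $\ker\mathbf p$, and let $e_{a,b}$ be the image of $v_a\otimes w_b$. For $0\le s\le t$ put $V^*_s=\{x\in V^*:|\{b\in\mathcal B:x(v_b)\neq0\}|<\aleph_s\}$ and $\mathfrak{gl}^M_s=\{\varphi\in\mathfrak{gl}^M:\varphi^*(V^*)\subset V^*_s\}$. For a module $M$ over a Lie algebra, $\mathrm{soc}\,M$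 is the sum of its simple submodules; put $\mathrm{soc}^0M=0$, and let $\mathrm{soc}^{q+1}M$ be the preimage in $M$ of $\mathrm{soc}(M/\mathrm{soc}^{q}M)$. Regard $\mathfrak{gl}^M$ as a module over itself by the adjoint action. (A) The following subspaces are nonzero proper ideals of $\mathfrak{gl}^M$, and every nonzero proper ideal is one of them: (i) $\mathbb C\,\mathrm{id}_V$, which is the center of $\mathfrak{gl}^M$; (ii) $\mathfrak{sl}(V,V_*)$; (iii) $\mathbb C\,\mathrm{id}_V\oplus\mathfrak{sl}(V,V_*)=\mathrm{soc}^1\mathfrak{gl}^M$ (the sum is direct); (iv) $\mathbb C(z\,\mathrm{id}_V+e_{b,b})+\mathfrak{sl}(V,V_*)\subset\mathrm{soc}^2\mathfrak{gl}^M$ for $z\in\mathbb C\setminus\{0\}$ and $b\in\mathcal B$; this ideal depends only on $z$ and not on $b$; (v) $\mathfrak{gl}^M_s\subset\mathrm{soc}^{s+2}\mathfrak{gl}^M$ for $s=0,\dots,t$, where $\mathfrak{gl}^M_0=\mathfrak{gl}(V,V_*)$; (vi) $\mathbb C\,\mathrm{id}_V\oplus\mathfrak{gl}^M_s=\mathrm{soc}^{s+2}\mathfrak{gl}^M$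 for $s=0,\dots,t$ (the sum is direct). (B) The nonzero ideals of $\mathfrak{gl}^M$ contained in $\mathfrak{gl}^M_t$ are exactly $\mathfrak{sl}(V,V_*)$ and $\mathfrak{gl}^M_s$ for $s\in\{0,\dots,t\}$. There is exactly one proper ideal of $\mathfrak{gl}^M$ strictly containing $\mathfrak{gl}^M_t$, namely $\mathbb C\,\mathrm{id}_V\oplus\mathfrak{gl}^M_t$. -/

import Mathlib

open scoped TensorProduct Cardinal

attribute [local instance 100] LieRing.ofAssociativeRing

noncomputable section

namespace Mackey

section Pairing

variable {V W : Type*} [AddCommGroup V] [Module ℂ V] [AddCommGroup W] [Module ℂ W]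

/-- The Mackey Lie algebra `gl^M(V, W)` of a bilinear pairing `p : V × W → ℂ`: the Lie algebra of all
linear operators `φ` on `V` whose dual operator on `V*` maps the image of `W` in `V*` into itself. -/
def glM (p : V →ₗ[ℂ] W →ₗ[ℂ] ℂ) : LieSubalgebra ℂ (Module.End ℂ V) where
  carrier := {φ | (LinearMap.range p.flip).map φ.dualMap ≤ LinearMap.range p.flip}
  zero_mem' := by
    rintro _ ⟨x, -, rfl⟩
    have h : (0 : Module.End ℂ V).dualMap x = 0 := by ext; simp
    rw [h]
    exact zero_mem _
  add_mem' := by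
    rintro φ ψ hφ hψ _ ⟨x, hx, rfl⟩
    have h : (φ + ψ).dualMap x = φ.dualMap x + ψ.dualMap x := by ext; simp
    rw [h]
    exact add_mem (hφ ⟨x, hx, rfl⟩) (hψ ⟨x, hx, rfl⟩)
  smul_mem' := by
    rintro c φ hφ _ ⟨x, hx, rfl⟩
    have h : (c • φ).dualMap x = c • φ.dualMap x := by ext; simp
    rw [h]
    exact Submodule.smul_mem _ c (hφ ⟨x, hx, rfl⟩)
  lie_mem' := by
    rintro φ ψ hφ hψ _ ⟨x, hx, rfl⟩
    have h : (⁅φ, ψ⁆ : Module.End ℂ V).dualMap x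
        = ψ.dualMap (φ.dualMap x) - φ.dualMap (ψ.dualMap x) := by
      ext; simp [LieRing.of_associative_ring_bracket]
    rw [h]
    exact sub_mem (hψ ⟨_, hφ ⟨x, hx, rfl⟩, rfl⟩) (hφ ⟨_, hψ ⟨x, hx, rfl⟩, rfl⟩)

/-- The operator on `V` attached to a tensor in `V ⊗ W`: `v ⊗ w` acts by `u ↦ p(u, w) v`. -/
def tensorToEnd (p : V →ₗ[ℂ] W →ₗ[ℂ] ℂ) : V ⊗[ℂ] W →ₗ[ℂ] Module.End ℂ V :=
  dualTensorHom ℂ V V ∘ₗ TensorProduct.map p.flip LinearMap.id ∘ₗ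
    (TensorProduct.comm ℂ V W).toLinearMap

theorem tensorToEnd_tmul (p : V →ₗ[ℂ] W →ₗ[ℂ] ℂ) (v : V) (w : W) (u : V) :
    tensorToEnd p (v ⊗ₜ w) u = p u w • v := by
  simp [tensorToEnd]

theorem tensorToEnd_mem (p : V →ₗ[ℂ] W →ₗ[ℂ] ℂ) (x : V ⊗[ℂ] W) : tensorToEnd p x ∈ glM p := by
  induction x with
  | zero => rw [map_zero]; exact zero_mem _
  | add x y hx hy => rw [map_add]; exact add_mem hx hy
  | tmul v w =>
    rintro _ ⟨_, ⟨y, rfl⟩, rfl⟩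
    refine ⟨p v y • w, ?_⟩
    ext u
    simp [tensorToEnd_tmul, mul_comm]

/-- The map `V ⊗ W → gl^M(V, W)`, `v ⊗ w ↦ (u ↦ p(u, w) v)`. -/
def tensorToGlM (p : V →ₗ[ℂ] W →ₗ[ℂ] ℂ) : V ⊗[ℂ] W →ₗ[ℂ] glM p :=
  (tensorToEnd p).codRestrict (glM p).toSubmodule (tensorToEnd_mem p)

/-- `gl(V, W)`, the image of `V ⊗ W` in `gl^M(V, W)`. -/
def glFin (p : V →ₗ[ℂ] W →ₗ[ℂ] ℂ) : Submodule ℂ (glM p) :=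
  LinearMap.range (tensorToGlM p)

/-- `sl(V, W)`, the image in `gl^M(V, W)` of the kernel of `p : V ⊗ W → ℂ`. -/
def sl (p : V →ₗ[ℂ] W →ₗ[ℂ] ℂ) : Submodule ℂ (glM p) :=
  (LinearMap.ker (TensorProduct.lift p)).map (tensorToGlM p)

/-- The identity operator of `V`, as an element of `gl^M(V, W)`. -/
def idM (p : V →ₗ[ℂ] W →ₗ[ℂ] ℂ) : glM p :=
  ⟨LinearMap.id, by
    rintro _ ⟨x, hx, rfl⟩
    exact hx⟩

/-- The scalar operators `ℂ id_V`. -/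
def scalars (p : V →ₗ[ℂ] W →ₗ[ℂ] ℂ) : Submodule ℂ (glM p) :=
  Submodule.span ℂ {idM p}

end Pairing

section Bases

variable {V W B : Type*} [AddCommGroup V] [Module ℂ V] [AddCommGroup W] [Module ℂ W]

/-- The bases `v` of `V` and `w` of `W` diagonalize the pairing `p`, i.e.
`p(x, y) = ∑ b, x(b) y(b)` in coordinates. -/
def IsDualPair (p : V →ₗ[ℂ] W →ₗ[ℂ] ℂ) (v : Module.Basis B ℂ V) (w : Module.Basis B ℂ W) : Prop :=
  ∀ (x : V) (y : W), p x y = (v.repr x).sum fun b c => c * w.repr y b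

/-- The subspace `V*_s` of all `x ∈ V*` with fewer than `ℵ_s` nonzero values on the basis `v`. -/
def dualFilt (v : Module.Basis B ℂ V) (s : ℕ) : Submodule ℂ (Module.Dual ℂ V) where
  carrier := {x | #{b : B | x (v b) ≠ 0} < ℵ_ s}
  zero_mem' := by simp [Cardinal.aleph_pos]
  add_mem' := by
    intro x y hx hy
    refine lt_of_le_of_lt ?_ (Cardinal.add_lt_of_lt (Cardinal.aleph0_le_aleph s) hx hy)
    refine le_trans (Cardinal.mk_le_mk_of_subset ?_) (Cardinal.mk_union_le _ _)
    intro b hb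
    by_contra h
    simp only [Set.mem_union, Set.mem_ofPred_eq, not_or, not_not] at h
    exact hb (by simp [h.1, h.2])
  smul_mem' := by
    intro c x hx
    refine lt_of_le_of_lt (Cardinal.mk_le_mk_of_subset ?_) hx
    intro b hb h
    exact hb (by simp [h])

/-- `gl^M_s`: all `φ ∈ gl^M` whose dual operator maps `V*` into `V*_s`. -/
def glMFilt (p : V →ₗ[ℂ] W →ₗ[ℂ] ℂ) (v : Module.Basis B ℂ V) (s : ℕ) : Submodule ℂ (glM p) where
  carrier := {φ | ∀ x : Module.Dual ℂ V, (φ : Module.End ℂ V).dualMap x ∈ dualFilt v s}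
  zero_mem' := by
    intro x
    have h : ((0 : glM p) : Module.End ℂ V).dualMap x = 0 := by ext; simp
    rw [h]
    exact zero_mem _
  add_mem' := by
    intro φ ψ hφ hψ x
    have h : ((φ + ψ : glM p) : Module.End ℂ V).dualMap x
        = (φ : Module.End ℂ V).dualMap x + (ψ : Module.End ℂ V).dualMap x := by ext; simp
    rw [h]
    exact add_mem (hφ x) (hψ x)
  smul_mem' := by
    intro c φ hφ x
    have h : ((c • φ : glM p) : Module.End ℂ V).dualMap x
        = c • (φ : Module.End ℂ V).dualMap x := by ext; simp
    rw [h]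
    exact Submodule.smul_mem _ c (hφ x)

/-- The elementary matrix `e_{a,b} = v_a ⊗ w_b`. -/
def elem (p : V →ₗ[ℂ] W →ₗ[ℂ] ℂ) (v : Module.Basis B ℂ V) (w : Module.Basis B ℂ W) (a b : B) :
    glM p :=
  tensorToGlM p (v a ⊗ₜ w b)

/-- The subspace `ℂ (z id_V + e_{b,b}) + sl(V, W)`. -/
def slExt (p : V →ₗ[ℂ] W →ₗ[ℂ] ℂ) (v : Module.Basis B ℂ V) (w : Module.Basis B ℂ W) (z : ℂ) (b : B) :
    Submodule ℂ (glM p) :=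
  Submodule.span ℂ {z • idM p + elem p v w b b} ⊔ sl p

end Bases

section Socle

/-- The socle of a Lie algebra module: the sum of its simple submodules. -/
def socle (L M : Type*) [LieRing L] [LieAlgebra ℂ L] [AddCommGroup M] [Module ℂ M]
    [LieRingModule L M] [LieModule ℂ L M] : LieSubmodule ℂ L M :=
  sSup {N | LieModule.IsIrreducible ℂ L N}

/-- The socle filtration: `soc^0 M = 0`, and `soc^(q+1) M` is the preimage in `M` of the socle of
`M / soc^q M`. -/
def soc (L M : Type*) [LieRing L] [LieAlgebra ℂ L] [AddCommGroup M] [Module ℂ M]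
    [LieRingModule L M] [LieModule ℂ L M] : ℕ → LieSubmodule ℂ L M
  | 0 => ⊥
  | q + 1 => (socle L (M ⧸ soc L M q)).comap (LieSubmodule.Quotient.mk' (soc L M q))

/-- A subspace of a Lie algebra is (the underlying subspace of) an ideal. -/
def IsIdeal {L : Type*} [LieRing L] [LieAlgebra ℂ L] (U : Submodule ℂ L) : Prop :=
  ∃ J : LieIdeal ℂ L, J.toSubmodule = U

end Socle

end Mackey

end

attribute [local instance 100] LieRing.ofAssociativeRing

noncomputable section

namespace Mackey

/-! ### Independent sets in locally finite relations -/

section Combinatorics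

/-! In the given bases, `gl^M` is the commutator Lie algebra of the associative algebra `A` of
row-finite matrices (columns are finite automatically), and `gl^M_s` consists of the matrices with
fewer than `ℵ_s` nonzero columns. For `κ = 1` or `κ` infinite, let `I_κ` be the two-sided ideal of
matrices in `A` with fewer than `κ` nonzero columns; thus `I_1 = 0`.

The engine concerns a Lie ideal `J` containing some `φ` that is not scalar modulo `I_κ`, where `κ ≤
#B`. A matrix `x` outside `I_κ` contains a diagonal pattern of size `κ`, so any projection onto at
most `κ` basis vectors has the form `u x w` (`exists_mul_mul_eq_projOp`). Hence `A / I_κ` is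
semiprime. Its center consists of scalars (`exists_sub_smul_one_mem`), so some `z = [φ, [φ, a]]`
lies outside `I_κ`. Herstein's argument gives `[A z A, A] ⊆ J`, and so `[y, A] ⊆ J` for every `y`
with at most `κ` nonzero columns (`IsLieIdealOf.comm_mem`). For `κ = 1` this yields `sl ⊆ J`. For `κ
= ℵ_s` a shift trick writes every such `y` as a sum of two commutators of the same kind, whence
`gl^M_{s+1} ⊆ J`.

So an ideal outside `ℂ id` contains `sl`, and one outside `ℂ id + gl^M_s` contains `gl^M_{s+1}`. For
an ideal `U` outside `ℂ id`, the least `s` with `U ⊆ ℂ id + gl^M_s` leaves finite-dimensional linear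
algebra: `U` lies between `gl^M_s` and `ℂ id + gl^M_s` if `s > 0`, and between `sl` and `ℂ id + gl`
if `s = 0`. The socle layers follow: the minimal ideals are `ℂ id` and `sl`, and each later layer up
to `soc^{t+2}` is the least ideal strictly above its predecessor. -/

theorem exists_maximal_independent {X : Type*} (r : X → X → Prop) :
    ∃ Y : Set X, (Y.Pairwise fun x y => ¬ r x y) ∧ ∀ x, x ∈ Y ∨ ∃ y ∈ Y, r x y ∨ r y x := by
  obtain ⟨Y, hY⟩ := zorn_subset {Y : Set X | Y.Pairwise fun x y => ¬ r x y} fun c hc hchain =>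
    ⟨⋃₀ c, (Set.pairwise_sUnion hchain.directedOn).2 hc, fun s hs => Set.subset_sUnion_of_mem hs⟩
  refine ⟨Y, hY.prop, fun x => ?_⟩
  by_contra! h
  refine h.1 (hY.le_of_ge (y := insert x Y) ?_ (Set.subset_insert x Y) (Set.mem_insert x Y))
  exact hY.prop.insert fun y hy _ => h.2 y hy

/-- The cardinals `κ` for which fewer than `κ` finite sets have a union of size less than `κ`. -/
def IsThreshold (κ : Cardinal) : Prop := κ = 1 ∨ ℵ₀ ≤ κ

theorem IsThreshold.pos {κ : Cardinal} (h : IsThreshold κ) : 0 < κ := by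
  rcases h with rfl | h
  · exact one_pos
  · exact Cardinal.aleph0_pos.trans_le h

universe u

theorem IsThreshold.mk_biUnion_lt {X Y : Type u} {κ : Cardinal.{u}} (hκ : IsThreshold κ) {S : Set X}
    {F : X → Set Y} (hS : #S < κ) (hF : ∀ x ∈ S, (F x).Finite) : #(⋃ x ∈ S, F x) < κ := by
  rcases hκ with rfl | hκ
  · rw [Cardinal.lt_one_iff, Cardinal.mk_set_eq_zero_iff] at hS
    simp [hS]
  rcases lt_or_ge #S ℵ₀ with h | h
  · refine lt_of_lt_of_le ?_ hκ
    rw [Cardinal.lt_aleph0_iff_set_finite] at h ⊢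
    exact h.biUnion hF
  · rw [Set.biUnion_eq_iUnion]
    refine lt_of_le_of_lt (Cardinal.mk_iUnion_le_sum_mk.trans
      (Cardinal.sum_le_sum _ (fun _ => ℵ₀) fun x => ?_)) (?_ : _ < κ)
    · exact (Cardinal.lt_aleph0_iff_set_finite.2 (hF x x.2)).le
    · simpa [Cardinal.mul_eq_left h h Cardinal.aleph0_ne_zero] using hS

theorem IsThreshold.mk_union_lt {X : Type u} {κ : Cardinal.{u}} (hκ : IsThreshold κ) {S T : Set X}
    (hS : #S < κ) (hT : #T < κ) : #(S ∪ T : Set X) < κ := by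
  rcases hκ with rfl | hκ
  · rw [Cardinal.lt_one_iff, Cardinal.mk_set_eq_zero_iff] at *
    simp [hS, hT]
  · exact (Cardinal.mk_union_le _ _).trans_lt (Cardinal.add_lt_of_lt hκ hS hT)

/-- A maximal independent set together with its neighbours covers `X`. If it had fewer than `κ`
elements, its finite neighbourhoods would cover fewer than `κ` points. -/
theorem IsThreshold.exists_independent {X : Type u} {κ : Cardinal.{u}} (hκ : IsThreshold κ)
    (hX : κ ≤ #X) (r : X → X → Prop) (h₁ : ∀ x, {y | r x y}.Finite) (h₂ : ∀ x, {y | r y x}.Finite) :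
    ∃ Y : Set X, (Y.Pairwise fun x y => ¬ r x y) ∧ κ ≤ #Y := by
  obtain ⟨Y, hY, hmax⟩ := exists_maximal_independent r
  refine ⟨Y, hY, ?_⟩
  by_contra! hlt
  have hlt' := hκ.mk_union_lt hlt (hκ.mk_biUnion_lt (F := fun x => {y | r x y} ∪ {y | r y x}) hlt
    fun x _ => (h₁ x).union (h₂ x))
  refine absurd hX (not_le.2 (lt_of_eq_of_lt ?_ hlt'))
  rw [← Cardinal.mk_univ]
  congr
  ext x
  simp only [Set.mem_univ, true_iff, Set.mem_union, Set.mem_iUnion]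
  rcases hmax x with h | ⟨y, hy, h⟩
  · exact Or.inl h
  · exact Or.inr ⟨y, hy, h.symm⟩

end Combinatorics

/-! ### Herstein's theorem on Lie ideals of associative algebras -/

section Ring

variable {R : Type*} [Ring R] [Algebra ℂ R]

/-- `J` is a Lie ideal of the subalgebra `A`. -/
structure IsLieIdealOf (J : Submodule ℂ R) (A : Subalgebra ℂ R) : Prop where
  le : ∀ x ∈ J, x ∈ A
  comm : ∀ x ∈ J, ∀ a ∈ A, x * a - a * x ∈ J

/-- Herstein's theorem on the associative ideal generated by the commutators of a Lie ideal. -/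
theorem IsLieIdealOf.comm_mul_comm_mul {J : Submodule ℂ R} {A : Subalgebra ℂ R}
    (hJ : IsLieIdealOf J A) {x y a b c : R} (hx : x ∈ J) (hy : y ∈ J) (ha : a ∈ A) (hb : b ∈ A)
    (hc : c ∈ A) : a * (x * y - y * x) * b * c - c * (a * (x * y - y * x) * b) ∈ J := by
  -- The idealizer `{z | [z, A] ⊆ J}` contains `J` and is closed under products because `[z z', d] =
  -- [z, z' d] + [z', d z]`.
  let T : Submodule ℂ R :=
    { carrier := {z | z ∈ A ∧ ∀ d ∈ A, z * d - d * z ∈ J}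
      zero_mem' := ⟨zero_mem _, fun d _ => by simp⟩
      add_mem' := fun {z z'} hz hz' => ⟨add_mem hz.1 hz'.1, fun d hd => by
        have := add_mem (hz.2 d hd) (hz'.2 d hd)
        rwa [show (z * d - d * z) + (z' * d - d * z') = (z + z') * d - d * (z + z') by
          noncomm_ring] at this⟩
      smul_mem' := fun r z hz => ⟨Subalgebra.smul_mem _ hz.1 r, fun d hd => by
        have := J.smul_mem r (hz.2 d hd)
        rwa [smul_sub, ← smul_mul_assoc, ← mul_smul_comm] at this⟩ }
  have hJT : ∀ z ∈ J, z ∈ T := fun z hz => ⟨hJ.le z hz, hJ.comm z hz⟩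
  have hT_mul : ∀ z ∈ T, ∀ z' ∈ T, z * z' ∈ T := fun z hz z' hz' => 
    ⟨mul_mem hz.1 hz'.1, fun d hd => by
      have := add_mem (hz.2 _ (mul_mem hz'.1 hd)) (hz'.2 _ (mul_mem hd hz.1))
      rwa [show (z * (z' * d) - z' * d * z) + (z' * (d * z) - d * z * z')
        = z * z' * d - d * (z * z') by noncomm_ring] at this⟩
  -- Uses `[x, y] d = [x, y d] - y [x, d]`. The left factor `a` is then moved in by `a [x, y] b =
  -- [x, y] b a - [[x, y] b, a]`.
  have hT_right : ∀ d ∈ A, (x * y - y * x) * d ∈ T := fun d hd => by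
    have h₁ : x * (y * d) - y * d * x ∈ T := hJT _ (hJ.comm x hx _ (mul_mem (hJ.le y hy) hd))
    have h₂ : y * (x * d - d * x) ∈ T := hT_mul _ (hJT y hy) _ (hJT _ (hJ.comm x hx d hd))
    have := sub_mem h₁ h₂
    rwa [show x * (y * d) - y * d * x - y * (x * d - d * x) = (x * y - y * x) * d by
      noncomm_ring] at this
  have h₁ : (x * y - y * x) * (b * a) ∈ T := hT_right _ (mul_mem hb ha)
  have h₂ : (x * y - y * x) * b * a - a * ((x * y - y * x) * b) ∈ T :=
    hJT _ ((hT_right b hb).2 a ha)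
  have h₃ := sub_mem h₁ h₂
  rw [show (x * y - y * x) * (b * a) - ((x * y - y * x) * b * a - a * ((x * y - y * x) * b))
    = a * (x * y - y * x) * b by noncomm_ring] at h₃
  exact h₃.2 c hc

end Ring

/-! ### Row-finite matrices and the ideals of matrices with few nonzero columns -/

section RowFinite

universe u

variable {V : Type*} {B : Type u} [AddCommGroup V] [Module ℂ V] (v : Module.Basis B ℂ V)

/-- A linear map evaluated at a vector only one coordinate of which matters. -/
theorem apply_eq_repr_smul {M : Type*} [AddCommGroup M] [Module ℂ M] (φ : V →ₗ[ℂ] M) (z : V) (a : B)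
    (h : ∀ a', a' ≠ a → v.repr z a' = 0 ∨ φ (v a') = 0) : φ z = v.repr z a • φ (v a) := by
  conv_lhs => rw [← v.linearCombination_repr z]
  rw [Finsupp.linearCombination_apply, map_finsuppSum, Finsupp.sum, Finset.sum_eq_single a]
  · simp
  · intro a' _ ha'
    rcases h a' ha' with h | h <;> simp [h]
  · intro ha
    simp [Finsupp.notMem_support_iff.1 ha]

theorem exists_repr_mul_ne_zero (φ : Module.End ℂ V) (z : V) (a : B) (h : v.repr (φ z) a ≠ 0) :
    ∃ c, v.repr z c ≠ 0 ∧ v.repr (φ (v c)) a ≠ 0 := by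
  by_contra! hc
  apply h
  have := apply_eq_repr_smul v (v.coord a ∘ₗ φ) z a fun c _ => by
    by_cases h0 : v.repr z c = 0
    · exact Or.inl h0
    · exact Or.inr (hc c h0)
  simp only [LinearMap.comp_apply, Module.Basis.coord_apply] at this
  rw [this]
  by_cases h0 : v.repr z a = 0
  · simp [h0]
  · simp [hc a h0]

/-- The algebra of operators whose matrix in the basis `v` has finite rows. -/
def rowFinite : Subalgebra ℂ (Module.End ℂ V) where
  carrier := {φ | ∀ a, {b | v.repr (φ (v b)) a ≠ 0}.Finite}
  mul_mem' := by
    intro φ ψ hφ hψ a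
    refine ((hφ a).biUnion fun c _ => hψ c).subset fun b hb => ?_
    obtain ⟨c, h₁, h₂⟩ := exists_repr_mul_ne_zero v φ (ψ (v b)) a hb
    exact Set.mem_biUnion (show c ∈ {c | v.repr (φ (v c)) a ≠ 0} from h₂) h₁
  add_mem' := by
    intro φ ψ hφ hψ a
    refine ((hφ a).union (hψ a)).subset fun b hb => ?_
    by_contra! h
    simp only [Set.mem_union, Set.mem_ofPred_eq, not_or, not_not] at h
    exact hb (by simp [h.1, h.2])
  algebraMap_mem' := by
    intro r a
    refine (Set.finite_singleton a).subset fun b hb => ?_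
    by_contra hne
    exact hb (by simp [Module.algebraMap_end_apply, show b ≠ a from hne])

/-- The indices of the nonzero columns of an operator. -/
def colSupp (φ : Module.End ℂ V) : Set B := {b | φ (v b) ≠ 0}

theorem mem_colSupp {φ : Module.End ℂ V} {b : B} : b ∈ colSupp v φ ↔ φ (v b) ≠ 0 := Iff.rfl

theorem colSupp_mul_subset_right (φ ψ : Module.End ℂ V) : colSupp v (φ * ψ) ⊆ colSupp v ψ :=
  fun b hb h => hb (by simp [h])

theorem colSupp_mul_subset_biUnion (φ ψ : Module.End ℂ V) :
    colSupp v (φ * ψ) ⊆ ⋃ c ∈ colSupp v φ, {b | v.repr (ψ (v b)) c ≠ 0} := by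
  intro b hb
  have : v.repr (φ (ψ (v b))) ≠ 0 := fun h => hb (v.repr.map_eq_zero_iff.1 h)
  obtain ⟨a, ha⟩ := Finsupp.ne_iff.1 this
  obtain ⟨c, h₁, h₂⟩ := exists_repr_mul_ne_zero v φ (ψ (v b)) a ha
  exact Set.mem_biUnion (show c ∈ colSupp v φ from fun h => h₂ (by simp [h])) h₁

/-- The row-finite operators with fewer than `κ` nonzero columns. -/
def smallOps {κ : Cardinal.{u}} (hκ : IsThreshold κ) : Submodule ℂ (Module.End ℂ V) where
  carrier := {φ | φ ∈ rowFinite v ∧ #(colSupp v φ) < κ}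
  zero_mem' := ⟨zero_mem _, by simpa [colSupp] using hκ.pos⟩
  add_mem' := by
    rintro φ ψ ⟨hφ, hφ'⟩ ⟨hψ, hψ'⟩
    refine ⟨add_mem hφ hψ, (Cardinal.mk_le_mk_of_subset fun b hb => ?_).trans_lt
      (hκ.mk_union_lt hφ' hψ')⟩
    by_contra h
    simp only [Set.mem_union, mem_colSupp, not_or, not_not] at h
    exact hb (by simp [h.1, h.2])
  smul_mem' := by
    rintro c φ ⟨hφ, hφ'⟩
    refine ⟨Subalgebra.smul_mem _ hφ c, (Cardinal.mk_le_mk_of_subset fun b hb h => ?_).trans_lt hφ'⟩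
    exact hb (by simp [h])

variable {v} {κ : Cardinal.{u}} (hκ : IsThreshold κ)

theorem le_mk_colSupp {φ : Module.End ℂ V} (hφ : φ ∈ rowFinite v) (h : φ ∉ smallOps v hκ) :
    κ ≤ #(colSupp v φ) := not_lt.1 fun h' => h ⟨hφ, h'⟩

theorem mul_mem_smallOps_left {a φ : Module.End ℂ V} (ha : a ∈ rowFinite v)
    (hφ : φ ∈ smallOps v hκ) : a * φ ∈ smallOps v hκ :=
  ⟨mul_mem ha hφ.1, (Cardinal.mk_le_mk_of_subset (colSupp_mul_subset_right v a φ)).trans_lt hφ.2⟩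

theorem mul_mem_smallOps_right {a φ : Module.End ℂ V} (ha : a ∈ rowFinite v)
    (hφ : φ ∈ smallOps v hκ) : φ * a ∈ smallOps v hκ :=
  ⟨mul_mem hφ.1 ha, (Cardinal.mk_le_mk_of_subset (colSupp_mul_subset_biUnion v φ a)).trans_lt
    (hκ.mk_biUnion_lt hφ.2 fun c _ => ha c)⟩

variable (v)

/-- The operator `v (g i) ↦ c i • v (f i)`, zero on the other basis vectors. -/
def monomialOp {ι : Type*} (f g : ι → B) (c : ι → ℂ) : Module.End ℂ V :=
  open Classical in
  v.constr ℂ fun b => if h : ∃ i, g i = b then c h.choose • v (f h.choose) else 0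

variable {v} {ι : Type*} {f g : ι → B} {c : ι → ℂ}

theorem monomialOp_apply (hg : g.Injective) (i : ι) :
    monomialOp v f g c (v (g i)) = c i • v (f i) := by
  have h : ∃ j, g j = g i := ⟨i, rfl⟩
  rw [monomialOp, v.constr_basis, dif_pos h, hg h.choose_spec]

theorem monomialOp_apply_of_notMem {b : B} (hb : b ∉ Set.range g) :
    monomialOp v f g c (v b) = 0 := by
  rw [monomialOp, v.constr_basis, dif_neg (fun ⟨i, hi⟩ => hb ⟨i, hi⟩)]

theorem monomialOp_mem (hf : f.Injective) (hg : g.Injective) :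
    monomialOp v f g c ∈ rowFinite v := by
  intro a
  refine Set.Subsingleton.finite fun b hb b' hb' => ?_
  have key : ∀ b, v.repr (monomialOp v f g c (v b)) a ≠ 0 → ∃ i, g i = b ∧ f i = a := by
    intro b hb
    by_cases h : b ∈ Set.range g
    · obtain ⟨i, rfl⟩ := h
      rw [monomialOp_apply hg] at hb
      refine ⟨i, rfl, ?_⟩
      by_contra hne
      exact hb (by simp [hne])
    · exact absurd (by simp [monomialOp_apply_of_notMem h]) hb
  obtain ⟨i, rfl, hi⟩ := key b hb
  obtain ⟨j, rfl, hj⟩ := key b' hb'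
  rw [hf (hi.trans hj.symm)]

theorem repr_monomialOp (hf : f.Injective) (hg : g.Injective) (z : V) (i : ι) :
    v.repr (monomialOp v f g c z) (f i) = c i * v.repr z (g i) := by
  have := apply_eq_repr_smul v (v.coord (f i) ∘ₗ monomialOp v f g c) z (g i) fun b hb => by
    right
    by_cases h : b ∈ Set.range g
    · obtain ⟨j, rfl⟩ := h
      have hji : f j ≠ f i := fun h => hb (by rw [hf h])
      simp [monomialOp_apply hg, hji]
    · simp [monomialOp_apply_of_notMem h]
  simpa [monomialOp_apply hg, mul_comm] using this

variable (v) in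
/-- The projection to the span of the `v b`, `b ∈ S`. -/
abbrev projOp (S : Set B) : Module.End ℂ V :=
  monomialOp v (fun s : S => (s : B)) (fun s : S => (s : B)) fun _ => 1

theorem projOp_mem (S : Set B) : projOp v S ∈ rowFinite v :=
  monomialOp_mem Subtype.val_injective Subtype.val_injective

theorem projOp_apply_of_mem {S : Set B} {b : B} (hb : b ∈ S) : projOp v S (v b) = v b := by
  simpa using monomialOp_apply (v := v) (f := fun s : S => (s : B)) (c := fun _ => 1)
    Subtype.val_injective ⟨b, hb⟩

theorem projOp_apply_of_notMem {S : Set B} {b : B} (hb : b ∉ S) : projOp v S (v b) = 0 :=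
  monomialOp_apply_of_notMem (by simpa using hb)

theorem colSupp_projOp (S : Set B) : colSupp v (projOp v S) = S := by
  ext b
  by_cases hb : b ∈ S
  · simp [mem_colSupp, projOp_apply_of_mem hb, hb, v.ne_zero]
  · simp [mem_colSupp, projOp_apply_of_notMem hb, hb]

theorem repr_projOp_of_notMem {S : Set B} {a : B} (ha : a ∉ S) (z : V) :
    v.repr (projOp v S z) a = 0 := by
  by_contra h
  obtain ⟨c, -, hc⟩ := exists_repr_mul_ne_zero v _ z a h
  by_cases hcS : c ∈ S
  · rw [projOp_apply_of_mem hcS] at hc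
    exact hc (by simp [show c ≠ a from fun h => ha (h ▸ hcS)])
  · exact hc (by simp [projOp_apply_of_notMem hcS])

/-- Choose a nonzero entry, in row `a b`, of each nonzero column `b`, and relate `b` to `b'` when
column `b'` meets row `a b`. Finite rows and columns make this relation locally finite. On an
independent set of columns the chosen rows cut out a diagonal submatrix with nonzero entries, which
a monomial matrix inverts. -/
theorem exists_leftInverse_on (hκ : IsThreshold κ) {x : Module.End ℂ V} (hx : x ∈ rowFinite v)
    (hxκ : κ ≤ #(colSupp v x)) {S : Set B} (hS : #S ≤ κ) :
    ∃ u ∈ rowFinite v, ∃ f : S → B, f.Injective ∧ ∀ s, u (x (v (f s))) = v s := by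
  have hex : ∀ b : colSupp v x, ∃ a, v.repr (x (v b)) a ≠ 0 := fun b =>
    Finsupp.ne_iff.1 fun h => b.2 (v.repr.map_eq_zero_iff.1 h)
  choose a ha using hex
  obtain ⟨Y, hY, hYκ⟩ := hκ.exists_independent hxκ
    (fun b b' => v.repr (x (v b')) (a b) ≠ 0)
    (fun b => (hx (a b)).preimage Subtype.val_injective.injOn)
    (fun b => by
      have hfin : {a' | v.repr (x (v b)) a' ≠ 0}.Finite :=
        (v.repr (x (v b))).hasFiniteSupport.subset fun a' h => by simpa using h
      refine ((hfin.biUnion fun a' _ => hx a').preimage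
        (Subtype.val_injective (p := (· ∈ colSupp v x))).injOn).subset fun b' hb' => ?_
      exact Set.mem_biUnion (x := a b') hb' (ha b'))
  obtain ⟨e⟩ := Cardinal.le_def S Y |>.1 (hS.trans hYκ)
  have hind : ∀ s s' : S, s ≠ s' → v.repr (x (v (e s' : colSupp v x))) (a (e s)) = 0 := by
    intro s s' hne
    by_contra h
    exact hY (e s).2 (e s').2 (fun h => hne (e.injective (Subtype.ext h))) h
  have hg : (fun s : S => a (e s)).Injective := by
    intro s s' hss
    by_contra hne
    have h := hind s s' hne
    rw [show a (e s) = a (e s') from hss] at h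
    exact ha _ h
  refine ⟨monomialOp v (fun s : S => (s : B)) (fun s => a (e s))
    (fun s => (v.repr (x (v (e s : colSupp v x))) (a (e s)))⁻¹),
    monomialOp_mem Subtype.val_injective hg, fun s => (e s : colSupp v x), ?_, fun s => ?_⟩
  · exact Subtype.val_injective.comp (Subtype.val_injective.comp e.injective)
  · rw [apply_eq_repr_smul v _ _ (a (e s)), monomialOp_apply hg, smul_smul,
      mul_inv_cancel₀ (ha _), one_smul]
    intro a' ha'
    by_cases h : a' ∈ Set.range fun s : S => a (e s)
    · obtain ⟨s', rfl⟩ := h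
      exact Or.inl (hind s' s fun h => ha' (by rw [h]))
    · exact Or.inr (monomialOp_apply_of_notMem h)

theorem exists_mul_mul_eq_projOp (hκ : IsThreshold κ) {x : Module.End ℂ V} (hx : x ∈ rowFinite v)
    (hxκ : κ ≤ #(colSupp v x)) {S : Set B} (hS : #S ≤ κ) :
    ∃ u ∈ rowFinite v, ∃ w ∈ rowFinite v, u * x * w = projOp v S := by
  obtain ⟨u, hu, f, hf, huf⟩ := exists_leftInverse_on hκ hx hxκ hS
  refine ⟨u, hu, monomialOp v f (fun s : S => (s : B)) fun _ => 1,
    monomialOp_mem hf Subtype.val_injective, v.ext fun b => ?_⟩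
  by_cases hb : b ∈ S
  · have := monomialOp_apply (v := v) (f := f) (g := fun s : S => (s : B)) (c := fun _ => 1)
      Subtype.val_injective ⟨b, hb⟩
    simp only [one_smul] at this
    simp [this, huf, projOp_apply_of_mem hb]
  · have := monomialOp_apply_of_notMem (v := v) (f := f) (g := fun s : S => (s : B))
      (c := fun _ => 1) (b := b) (by simpa using hb)
    simp [this, projOp_apply_of_notMem hb]

/-- Semiprimeness modulo small operators: if `u x w` is a projection of rank `κ`, its square `u (x
(w u) x) w` is that same projection and cannot be small. -/
theorem mem_smallOps_of_mul_mul_self {x : Module.End ℂ V} (hx : x ∈ rowFinite v) (hB : κ ≤ #B)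
    (h : ∀ a ∈ rowFinite v, x * a * x ∈ smallOps v hκ) : x ∈ smallOps v hκ := by
  by_contra hxs
  obtain ⟨S, hS⟩ := Cardinal.le_mk_iff_exists_set.1 hB
  obtain ⟨u, hu, w, hw, huw⟩ := exists_mul_mul_eq_projOp hκ hx (le_mk_colSupp hκ hx hxs) hS.le
  have h₁ := mul_mem_smallOps_right hκ hw (mul_mem_smallOps_left hκ hu (h _ (mul_mem hw hu)))
  rw [show u * (x * (w * u) * x) * w = (u * x * w) * (u * x * w) by noncomm_ring, huw] at h₁
  refine absurd h₁.2 (not_lt.2 (hS.symm.le.trans (Cardinal.mk_le_mk_of_subset fun b hb => ?_)))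
  simp [mem_colSupp, projOp_apply_of_mem hb, v.ne_zero]

end RowFinite

/-! ### Operators central modulo small ones, and the main containment for Lie ideals -/

section CenterModSmall

universe u

variable {V : Type*} {B : Type u} [AddCommGroup V] [Module ℂ V] {v : Module.Basis B ℂ V}
  {κ : Cardinal.{u}} (hκ : IsThreshold κ)

/-- If `κ` columns `b` had an off-diagonal entry in a row `a b`, independence would give `κ` of
them, forming a set `S`, whose rows `a b` avoid `S`. The commutator with the projection to `S` keeps
all these entries. -/
theorem mk_offDiagonal_lt {φ : Module.End ℂ V} (hφ : φ ∈ rowFinite v)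
    (h : ∀ a ∈ rowFinite v, φ * a - a * φ ∈ smallOps v hκ) :
    #{b | ∃ a, a ≠ b ∧ v.repr (φ (v b)) a ≠ 0} < κ := by
  by_contra! hD
  choose a hab ha using fun b : {b | ∃ a, a ≠ b ∧ v.repr (φ (v b)) a ≠ 0} => b.2
  obtain ⟨Y, hY, hYκ⟩ := hκ.exists_independent hD (fun b b' => a b = b')
    (fun b => Set.Finite.preimage Subtype.val_injective.injOn (Set.finite_singleton (a b)) |>.subset
      fun b' hb' => (show a b = b' from hb').symm)
    (fun b => ((hφ b).preimage Subtype.val_injective.injOn).subset fun b' hb' => by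
      have := ha b'
      rwa [show a b' = b from hb'] at this)
  let S : Set B := Subtype.val '' Y
  refine absurd (h _ (projOp_mem S)).2 (not_lt.2 (hYκ.trans ?_))
  rw [← Cardinal.mk_image_eq (s := Y) Subtype.val_injective]
  refine Cardinal.mk_le_mk_of_subset ?_
  rintro _ ⟨b, hb, rfl⟩ h0
  have haS : a b ∉ S := by
    rintro ⟨b', hb', hbb'⟩
    exact hY hb hb' (fun h => hab b (by rw [← hbb', h])) hbb'.symm
  apply ha b
  have := congrArg (fun z => v.repr z (a b)) h0
  simpa [projOp_apply_of_mem (v := v) (show (b : B) ∈ S from ⟨b, hb, rfl⟩),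
    repr_projOp_of_notMem haS] using this

/-- Take a maximal family of disjoint pairs with distinct diagonal values. The monomial operator
sending the second member of each pair to the first has a commutator with `φ` whose entry there is
the difference of the two values. So there are fewer than `κ` pairs, and by maximality the diagonal
is constant off them. -/
theorem exists_mk_diagonal_ne_lt {φ : Module.End ℂ V}
    (h : ∀ a ∈ rowFinite v, φ * a - a * φ ∈ smallOps v hκ) :
    ∃ c : ℂ, #{b | v.repr (φ (v b)) b ≠ c} < κ := by
  set d : B → ℂ := fun b => v.repr (φ (v b)) b with hd
  obtain ⟨Y, hY, hmax⟩ := exists_maximal_independent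
    fun q q' : {q : B × B // d q.1 ≠ d q.2} =>
      q.1.1 = q'.1.1 ∨ q.1.1 = q'.1.2 ∨ q.1.2 = q'.1.1 ∨ q.1.2 = q'.1.2
  have hYκ : #Y < κ := by
    have hf : (fun q : Y => q.1.1.1).Injective := fun q q' hq => by
      by_contra hne
      exact hY q.2 q'.2 (fun h => hne (Subtype.ext h)) (Or.inl hq)
    have hg : (fun q : Y => q.1.1.2).Injective := fun q q' hq => by
      by_contra hne
      exact hY q.2 q'.2 (fun h => hne (Subtype.ext h)) (Or.inr (Or.inr (Or.inr hq)))
    refine lt_of_le_of_lt ?_ (h _ (monomialOp_mem (c := fun _ => 1) hf hg)).2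
    rw [← Cardinal.mk_range_eq _ hg]
    refine Cardinal.mk_le_mk_of_subset ?_
    rintro _ ⟨q, rfl⟩ h0
    apply q.1.2
    have h₁ := congrArg (fun z => v.repr z q.1.1.1) h0
    have h₂ := monomialOp_apply (v := v) (c := fun _ => 1) (f := fun q : Y => q.1.1.1) hg q
    have h₃ := repr_monomialOp (v := v) (c := fun _ => 1) hf hg (φ (v q.1.1.2)) q
    simp only [one_smul, one_mul] at h₂ h₃
    simp only [LinearMap.sub_apply, Module.End.mul_apply, h₂, map_sub, map_zero,
      Finsupp.coe_sub, Pi.sub_apply, Finsupp.coe_zero, Pi.zero_apply, h₃] at h₁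
    exact sub_eq_zero.1 h₁
  set Z : Set B := ⋃ q ∈ Y, {q.1.1, q.1.2} with hZ
  have hZκ : #Z < κ := hκ.mk_biUnion_lt hYκ fun q _ => Set.toFinite _
  have hconst : ∀ b ∉ Z, ∀ b' ∉ Z, d b = d b' := by
    intro b hb b' hb'
    by_contra hne
    have hmem : ∀ q ∈ Y, q.1.1 ∈ Z ∧ q.1.2 ∈ Z := fun q hq =>
      ⟨Set.mem_biUnion hq (by simp), Set.mem_biUnion hq (by simp)⟩
    rcases hmax ⟨(b, b'), hne⟩ with hY' | ⟨q, hq, h⟩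
    · exact hb (hmem _ hY').1
    · have := hmem q hq
      grind
  by_cases hex : ∃ b₀, b₀ ∉ Z
  · obtain ⟨b₀, hb₀⟩ := hex
    refine ⟨d b₀, (Cardinal.mk_le_mk_of_subset fun b hb => ?_).trans_lt hZκ⟩
    by_contra hbZ
    exact hb (hconst b hbZ b₀ hb₀)
  -- Here the pairs exhaust `B`, so `B` has fewer than `κ` elements and any scalar would do.
  · push Not at hex
    exact ⟨0, (Cardinal.mk_le_mk_of_subset fun b _ => hex b).trans_lt hZκ⟩

theorem exists_sub_smul_one_mem {φ : Module.End ℂ V} (hφ : φ ∈ rowFinite v)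
    (h : ∀ a ∈ rowFinite v, φ * a - a * φ ∈ smallOps v hκ) :
    ∃ c : ℂ, φ - c • 1 ∈ smallOps v hκ := by
  obtain ⟨c, hc⟩ := exists_mk_diagonal_ne_lt hκ h
  refine ⟨c, sub_mem hφ (Subalgebra.smul_mem _ (one_mem _) c),
    (Cardinal.mk_le_mk_of_subset fun b hb => ?_).trans_lt
      (hκ.mk_union_lt hc (mk_offDiagonal_lt hκ hφ h))⟩
  by_contra hb'
  simp only [Set.mem_union, Set.mem_ofPred_eq, not_or, not_not, not_exists, not_and] at hb'
  apply hb
  have := apply_eq_repr_smul v (LinearMap.id) (φ (v b)) b fun a ha => Or.inl (hb'.2 a ha)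
  simp only [LinearMap.id_coe, id_eq] at this
  simp only [LinearMap.sub_apply, LinearMap.smul_apply, Module.End.one_apply]
  rw [this, hb'.1, sub_self]

/-- For the derivation `δ = [φ, ·]`, expanding `δ²(ab)` when `δ² ≡ 0` leaves `2 δ(a) δ(b) ≡ 0`.
Replacing `b` by `c a` gives `δ(a) c δ(a) ≡ 0`, and semiprimeness finishes. -/
theorem comm_mem_smallOps_of_comm_comm {φ : Module.End ℂ V} (hφ : φ ∈ rowFinite v) (hB : κ ≤ #B)
    (h : ∀ a ∈ rowFinite v, φ * (φ * a - a * φ) - (φ * a - a * φ) * φ ∈ smallOps v hκ)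
    {a : Module.End ℂ V} (ha : a ∈ rowFinite v) : φ * a - a * φ ∈ smallOps v hκ := by
  have hmul : ∀ a ∈ rowFinite v, ∀ b ∈ rowFinite v,
      (φ * a - a * φ) * (φ * b - b * φ) ∈ smallOps v hκ := by
    intro a ha b hb
    have h₁ := sub_mem (sub_mem (h _ (mul_mem ha hb)) (mul_mem_smallOps_right hκ hb (h a ha)))
      (mul_mem_smallOps_left hκ ha (h b hb))
    have h₂ := (smallOps v hκ).smul_mem (2⁻¹ : ℂ) h₁
    convert h₂ using 1
    rw [eq_inv_smul_iff₀ two_ne_zero, two_smul]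
    noncomm_ring
  refine mem_smallOps_of_mul_mul_self hκ (sub_mem (mul_mem hφ ha) (mul_mem ha hφ)) hB fun c hc => ?_
  have := sub_mem (hmul a ha _ (mul_mem hc ha)) (mul_mem_smallOps_right hκ ha (hmul a ha c hc))
  convert this using 1
  noncomm_ring

theorem IsLieIdealOf.comm_mem {J : Submodule ℂ (Module.End ℂ V)} (hJ : IsLieIdealOf J (rowFinite v))
    (hB : κ ≤ #B) {φ : Module.End ℂ V} (hφ : φ ∈ J) (hφκ : ∀ c : ℂ, φ - c • 1 ∉ smallOps v hκ)
    {y c : Module.End ℂ V} (hy : y ∈ rowFinite v) (hyκ : #(colSupp v y) ≤ κ)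
    (hc : c ∈ rowFinite v) : y * c - c * y ∈ J := by
  have hφA := hJ.le φ hφ
  have hex : ∃ a ∈ rowFinite v, φ * (φ * a - a * φ) - (φ * a - a * φ) * φ ∉ smallOps v hκ := by
    by_contra! h
    obtain ⟨c, hc⟩ := exists_sub_smul_one_mem hκ hφA fun a ha =>
      comm_mem_smallOps_of_comm_comm hκ hφA hB h ha
    exact hφκ c hc
  obtain ⟨a, ha, hz⟩ := hex
  have haJ := hJ.comm φ hφ a ha
  obtain ⟨u, hu, w, hw, huw⟩ := exists_mul_mul_eq_projOp hκ
    (sub_mem (mul_mem hφA (hJ.le _ haJ)) (mul_mem (hJ.le _ haJ) hφA))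
    (le_mk_colSupp hκ (sub_mem (mul_mem hφA (hJ.le _ haJ)) (mul_mem (hJ.le _ haJ) hφA)) hz) hyκ
  have := hJ.comm_mul_comm_mul hφ haJ (mul_mem hy hu) hw hc
  -- With `z = [φ, [φ, a]]` and `u z w` the projection to the nonzero columns of `y`, we have `y =
  -- (y u) z w`, the shape to which Herstein's theorem applies.
  rwa [mul_assoc y, mul_assoc y, huw, show y * projOp v (colSupp v y) = y from ?_] at this
  refine v.ext fun b => ?_
  by_cases hb : b ∈ colSupp v y
  · simp [projOp_apply_of_mem hb]
  · simp [projOp_apply_of_notMem hb, not_not.1 hb]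

end CenterModSmall

/-! ### Operators as sums of two commutators -/

section Shift

universe u

variable {V : Type*} {B : Type u} [AddCommGroup V] [Module ℂ V] {v : Module.Basis B ℂ V}

/-- An infinite-swindle argument. Split the basis into countably many copies of itself, with `U n`
the embedding onto copy `n`, `U'` the left inverse of `U 0` killing the other copies, `s` and `s'`
the forward and backward shifts, and `D` the copy of `y` on every block. Then `[-U 0 * y, U'] = y -
U 0 * y * U'` and `[-s * D, s'] = D - s * D * s' = U 0 * y * U'`. -/
theorem exists_eq_add_comm {κ : Cardinal.{u}} (hκ : ℵ₀ ≤ κ) (hB : ℵ₀ ≤ #B) {y : Module.End ℂ V}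
    (hy : y ∈ rowFinite v) (hyκ : #(colSupp v y) ≤ κ) :
    ∃ a ∈ rowFinite v, ∃ b ∈ rowFinite v, ∃ a' ∈ rowFinite v, ∃ b' ∈ rowFinite v,
      #(colSupp v a) ≤ κ ∧ #(colSupp v a') ≤ κ ∧ y = (a * b - b * a) + (a' * b' - b' * a') := by
  have hcard : #(ULift.{u} ℕ × B) = #B := by
    simp [Cardinal.mul_eq_right hB hB Cardinal.aleph0_ne_zero]
  obtain ⟨e'⟩ := Cardinal.eq.1 hcard
  let e : ℕ × B ≃ B := (Equiv.prodCongr Equiv.ulift.symm (Equiv.refl B)).trans e'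
  have he : ∀ n, (fun b => e (n, b)).Injective := fun n b b' h => by
    simpa using e.injective h
  have hid : (fun b : B => b).Injective := Function.injective_id
  have hs : (fun q : ℕ × B => e (q.1 + 1, q.2)).Injective := fun q q' h => by
    have := e.injective h
    simp only [Prod.mk.injEq, add_left_inj] at this
    exact Prod.ext this.1 this.2
  let U : ℕ → Module.End ℂ V := fun n => monomialOp v (fun b => e (n, b)) (fun b => b) fun _ => 1
  have hU : ∀ n b, U n (v b) = v (e (n, b)) := fun n b => by
    simpa using monomialOp_apply (v := v) (f := fun b => e (n, b)) (c := fun _ => 1) hid b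
  have hUA : ∀ n, U n ∈ rowFinite v := fun n => monomialOp_mem (he n) hid
  let U' : Module.End ℂ V := monomialOp v (fun b => b) (fun b => e (0, b)) fun _ => 1
  have hU' : ∀ b, U' (v (e (0, b))) = v b := fun b => by
    simpa using monomialOp_apply (v := v) (f := fun b => b) (c := fun _ => 1) (he 0) b
  have hU'0 : ∀ n b, U' (v (e (n + 1, b))) = 0 := fun n b =>
    monomialOp_apply_of_notMem (by simp)
  have hU'A : U' ∈ rowFinite v := monomialOp_mem hid (he 0)
  let s : Module.End ℂ V := monomialOp v (fun q => e (q.1 + 1, q.2)) e fun _ => 1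
  have hsv : ∀ n b, s (v (e (n, b))) = v (e (n + 1, b)) := fun n b => by
    simpa using monomialOp_apply (v := v) (f := fun q => e (q.1 + 1, q.2)) (c := fun _ => 1)
      e.injective (n, b)
  have hsA : s ∈ rowFinite v := monomialOp_mem hs e.injective
  let s' : Module.End ℂ V := monomialOp v e (fun q => e (q.1 + 1, q.2)) fun _ => 1
  have hs'v : ∀ n b, s' (v (e (n + 1, b))) = v (e (n, b)) := fun n b => by
    simpa using monomialOp_apply (v := v) (f := e) (c := fun _ => 1) hs (n, b)
  have hs'0 : ∀ b, s' (v (e (0, b))) = 0 := fun b =>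
    monomialOp_apply_of_notMem (by simp)
  have hs'A : s' ∈ rowFinite v := monomialOp_mem e.injective hs
  let D : Module.End ℂ V := v.constr ℂ fun b => U (e.symm b).1 (y (v (e.symm b).2))
  have hD : ∀ n b, D (v (e (n, b))) = U n (y (v b)) := fun n b => by
    simp [D, v.constr_basis]
  have hreprU : ∀ n m z b, v.repr (U n z) (e (m, b)) = if n = m then v.repr z b else 0 := by
    intro n m z b
    split_ifs with h
    · subst h
      simpa using repr_monomialOp (v := v) (c := fun _ => 1) (he n) hid z b
    · by_contra h0
      obtain ⟨c, -, hc⟩ := exists_repr_mul_ne_zero v _ z _ h0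
      rw [hU] at hc
      exact hc (by simp [h])
  have hDA : D ∈ rowFinite v := by
    intro a
    obtain ⟨⟨m, b⟩, rfl⟩ := e.surjective a
    refine ((hy b).image fun b' => e (m, b')).subset fun a' ha' => ?_
    obtain ⟨⟨n, b'⟩, rfl⟩ := e.surjective a'
    simp only [Set.mem_ofPred_eq, hD, hreprU] at ha'
    split_ifs at ha' with h
    · exact ⟨b', ha', by rw [h]⟩
    · exact absurd rfl ha'
  -- Infinite `κ` absorbs the factor `ℵ₀` coming from the copies.
  have hDκ : #(colSupp v D) ≤ κ := by
    have hsub : colSupp v D ⊆ ⋃ n : ULift.{u} ℕ, (fun b => e (n.down, b)) '' colSupp v y := by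
      intro a ha
      obtain ⟨⟨n, b⟩, rfl⟩ := e.surjective a
      refine Set.mem_iUnion.2 ⟨⟨n⟩, b, fun h => ha ?_, rfl⟩
      rw [hD, h, map_zero]
    refine (Cardinal.mk_le_mk_of_subset hsub).trans (Cardinal.mk_iUnion_le_sum_mk.trans
      ((Cardinal.sum_le_sum _ (fun _ => κ) fun n => Cardinal.mk_image_le.trans hyκ).trans ?_))
    simp [Cardinal.mul_eq_right hκ hκ Cardinal.aleph0_ne_zero]
  have hsD : ∀ n z, s (U n z) = U (n + 1) z := fun n z => by
    have : s * U n = U (n + 1) := v.ext fun b => by simp [hU, hsv]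
    exact LinearMap.congr_fun this z
  have hs'U : ∀ n z, s' (U (n + 1) z) = U n z := fun n z => by
    have : s' * U (n + 1) = U n := v.ext fun b => by simp [hU, hs'v]
    exact LinearMap.congr_fun this z
  have hU'U : ∀ z, U' (U 0 z) = z := fun z => by
    have : U' * U 0 = 1 := v.ext fun b => by simp [hU, hU']
    exact LinearMap.congr_fun this z
  refine ⟨-U 0 * y, mul_mem (neg_mem (hUA 0)) hy, U', hU'A, -s * D,
    mul_mem (neg_mem hsA) hDA, s', hs'A,
    (Cardinal.mk_le_mk_of_subset (colSupp_mul_subset_right v _ _)).trans hyκ,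
    (Cardinal.mk_le_mk_of_subset (colSupp_mul_subset_right v _ _)).trans hDκ, v.ext fun a => ?_⟩
  · obtain ⟨⟨n, b⟩, rfl⟩ := e.surjective a
    cases n with
    | zero => simp [hU', hU'U, hs'0, hD, hsD, hs'U]
    | succ n => simp [hU'0, hU'U, hs'v, hD, hsD, hs'U]

theorem IsLieIdealOf.mem_of_le {κ : Cardinal.{u}} (hκ : ℵ₀ ≤ κ)
    {J : Submodule ℂ (Module.End ℂ V)} (hJ : IsLieIdealOf J (rowFinite v))
    (hB : κ ≤ #B) {φ : Module.End ℂ V} (hφ : φ ∈ J)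
    (hφκ : ∀ c : ℂ, φ - c • 1 ∉ smallOps v (Or.inr hκ))
    {y : Module.End ℂ V} (hy : y ∈ rowFinite v) (hyκ : #(colSupp v y) ≤ κ) : y ∈ J := by
  obtain ⟨a, ha, b, hb, a', ha', b', hb', haκ, ha'κ, rfl⟩ :=
    exists_eq_add_comm hκ (hκ.trans hB) hy hyκ
  exact add_mem (hJ.comm_mem _ hB hφ hφκ ha haκ hb) (hJ.comm_mem _ hB hφ hφκ ha' ha'κ hb')

end Shift

/-! ### Matrix description of `gl^M` and containments for its ideals -/

section DualPair

universe u

variable {V W : Type*} {B : Type u} [AddCommGroup V] [Module ℂ V] [AddCommGroup W] [Module ℂ W]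
  {p : V →ₗ[ℂ] W →ₗ[ℂ] ℂ} {v : Module.Basis B ℂ V} {w : Module.Basis B ℂ W}

theorem IsDualPair.apply_right (hp : IsDualPair p v w) (x : V) (b : B) :
    p x (w b) = v.repr x b := by
  classical
  rw [hp, Finsupp.sum, Finset.sum_eq_single b]
  · simp
  · intro c _ hc
    simp [hc.symm]
  · intro hb
    simp [Finsupp.notMem_support_iff.1 hb]

theorem IsDualPair.apply_left (hp : IsDualPair p v w) (b : B) (y : W) :
    p (v b) y = w.repr y b := by
  rw [hp, v.repr_self, Finsupp.sum_single_index] <;> simp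

/-- Row `a` of `φ` lists the values of `φ^*(w_a)` on the basis `v`, and a functional comes from `W`
exactly when it has finitely many nonzero values there. -/
theorem IsDualPair.mem_glM_iff (hp : IsDualPair p v w) {φ : Module.End ℂ V} :
    φ ∈ glM p ↔ φ ∈ rowFinite v := by
  constructor
  · intro hφ a
    obtain ⟨y, hy⟩ := hφ ⟨_, ⟨w a, rfl⟩, rfl⟩
    refine (w.repr y).hasFiniteSupport.subset fun b hb => ?_
    have := LinearMap.congr_fun hy (v b)
    simp only [LinearMap.flip_apply, LinearMap.dualMap_apply, hp.apply_right,
      hp.apply_left] at this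
    rw [Function.mem_support, this]
    exact hb
  · rintro hφ _ ⟨_, ⟨y, rfl⟩, rfl⟩
    suffices ⊤ ≤ (LinearMap.range p.flip).comap (φ.dualMap ∘ₗ p.flip) from this (x := y) trivial
    rw [← w.span_eq, Submodule.span_le]
    rintro _ ⟨a, rfl⟩
    refine ⟨w.repr.symm (Finsupp.ofSupportFinite (fun b => v.repr (φ (v b)) a) (hφ a)),
      v.ext fun b => ?_⟩
    simp [hp.apply_left, hp.apply_right]
    rfl

theorem IsDualPair.coe_mem (hp : IsDualPair p v w) (φ : glM p) :
    (φ : Module.End ℂ V) ∈ rowFinite v := hp.mem_glM_iff.1 φ.2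

theorem isThreshold_aleph (s : Ordinal.{u}) : IsThreshold (ℵ_ s) :=
  Or.inr (Cardinal.aleph0_le_aleph s)

theorem IsDualPair.mem_glMFilt_iff (hp : IsDualPair p v w) {s : ℕ} {φ : glM p} :
    φ ∈ glMFilt p v s ↔ #(colSupp v (φ : Module.End ℂ V)) < ℵ_ s := by
  constructor
  · intro hφ
    by_contra! hlt
    obtain ⟨S, -, hS⟩ := Cardinal.le_mk_iff_exists_subset.1 hlt
    obtain ⟨u, hu, f, hf, huf⟩ :=
      exists_leftInverse_on (isThreshold_aleph s) (hp.coe_mem φ) hlt hS.le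
    -- The functional `u` followed by the sum of coordinates takes the value `1` on all `ℵ_s`
    -- columns selected by `f`, so a single functional detects them.
    have h : #{b : B | ((v.constr ℂ fun _ => (1 : ℂ)) ∘ₗ u) ((φ : Module.End ℂ V) (v b)) ≠ 0} < _ :=
      hφ ((v.constr ℂ fun _ => (1 : ℂ)) ∘ₗ u)
    refine absurd h (not_lt.2 ?_)
    rw [← hS, ← Cardinal.mk_range_eq f hf]
    refine Cardinal.mk_le_mk_of_subset ?_
    rintro _ ⟨b, rfl⟩
    simp [huf, v.constr_basis]
  · intro hφ x
    have hsub : {b : B | x ((φ : Module.End ℂ V) (v b)) ≠ 0} ⊆ colSupp v (φ : Module.End ℂ V) :=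
      fun b hb h => hb (by simp [h])
    exact (Cardinal.mk_le_mk_of_subset hsub).trans_lt hφ

theorem isIdeal_iff {L : Type*} [LieRing L] [LieAlgebra ℂ L] {U : Submodule ℂ L} :
    IsIdeal U ↔ ∀ a x : L, x ∈ U → ⁅a, x⁆ ∈ U := by
  constructor
  · rintro ⟨J, rfl⟩ a x hx
    exact J.lie_mem hx
  · intro h
    exact ⟨{ U with lie_mem := fun {a x} hx => h a x hx }, rfl⟩

theorem IsIdeal.sup {L : Type*} [LieRing L] [LieAlgebra ℂ L] {U U' : Submodule ℂ L}
    (h : IsIdeal U) (h' : IsIdeal U') : IsIdeal (U ⊔ U') := by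
  obtain ⟨J, rfl⟩ := h
  obtain ⟨J', rfl⟩ := h'
  exact ⟨J ⊔ J', LieSubmodule.sup_toSubmodule J J'⟩

theorem IsDualPair.isLieIdealOf (hp : IsDualPair p v w) {U : Submodule ℂ (glM p)}
    (hU : IsIdeal U) : IsLieIdealOf (U.map (glM p).toSubmodule.subtype) (rowFinite v) where
  le := by
    rintro _ ⟨x, -, rfl⟩
    exact hp.coe_mem x
  comm := by
    rintro _ ⟨x, hx, rfl⟩ a ha
    refine ⟨-⁅(⟨a, hp.mem_glM_iff.2 ha⟩ : glM p), x⁆, neg_mem (isIdeal_iff.1 hU _ _ hx), ?_⟩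
    change -(a * (x : Module.End ℂ V) - x * a) = _
    simp

theorem elem_apply (hp : IsDualPair p v w) (a b : B) (x : V) :
    (elem p v w a b : Module.End ℂ V) x = v.repr x b • v a := by
  rw [← hp.apply_right]
  exact tensorToEnd_tmul p (v a) (w b) x

theorem elem_lie_elem_of_ne (hp : IsDualPair p v w) {a b : B} (h : a ≠ b) :
    ⁅elem p v w a b, elem p v w b b⁆ = elem p v w a b := by
  refine Subtype.ext (LinearMap.ext fun x => ?_)
  change (elem p v w a b : Module.End ℂ V) ((elem p v w b b : Module.End ℂ V) x)
    - (elem p v w b b : Module.End ℂ V) ((elem p v w a b : Module.End ℂ V) x) = _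
  simp [elem_apply hp, h]

theorem elem_lie_elem_swap (hp : IsDualPair p v w) (a b : B) :
    ⁅elem p v w a b, elem p v w b a⁆ = elem p v w a a - elem p v w b b := by
  refine Subtype.ext (LinearMap.ext fun x => ?_)
  change (elem p v w a b : Module.End ℂ V) ((elem p v w b a : Module.End ℂ V) x)
    - (elem p v w b a : Module.End ℂ V) ((elem p v w a b : Module.End ℂ V) x)
    = (elem p v w a a : Module.End ℂ V) x - (elem p v w b b : Module.End ℂ V) x
  simp [elem_apply hp]

variable (v w) in
-- Modulo `N`, a tensor reduces to its trace times one diagonal unit. It serves both for `N = sl`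
-- and for an arbitrary ideal that must contain the traceless tensors.
theorem tensorToGlM_sub_smul_mem (N : Submodule ℂ (glM p)) (b₀ : B)
    (h₁ : ∀ a b, a ≠ b → elem p v w a b ∈ N) (h₂ : ∀ a, elem p v w a a - elem p v w b₀ b₀ ∈ N)
    (hp : IsDualPair p v w) (τ : V ⊗[ℂ] W) :
    tensorToGlM p τ - TensorProduct.lift p τ • elem p v w b₀ b₀ ∈ N := by
  classical
  suffices ⊤ ≤ N.comap (tensorToGlM p - (TensorProduct.lift p).smulRight (elem p v w b₀ b₀)) from
    this (x := τ) trivial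
  rw [← (v.tensorProduct w).span_eq, Submodule.span_le]
  rintro _ ⟨⟨a, b⟩, rfl⟩
  have hpab : p (v a) (w b) = if a = b then 1 else 0 := by
    rw [hp.apply_right, v.repr_self, Finsupp.single_apply]
  by_cases hab : a = b
  · subst hab
    simpa [hpab, elem] using h₂ a
  · simpa [hpab, hab, elem] using h₁ a b hab

theorem elem_mem_sl (hp : IsDualPair p v w) {a b : B} (h : a ≠ b) : elem p v w a b ∈ sl p :=
  ⟨v a ⊗ₜ w b, by simp [hp.apply_right, h], rfl⟩

theorem elem_sub_elem_mem_sl (hp : IsDualPair p v w) (a b : B) :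
    elem p v w a a - elem p v w b b ∈ sl p :=
  ⟨v a ⊗ₜ w a - v b ⊗ₜ w b, by simp [hp.apply_right], by simp [elem]⟩

theorem glFin_eq_sup (hp : IsDualPair p v w) (b : B) :
    glFin p = Submodule.span ℂ {elem p v w b b} ⊔ sl p := by
  apply le_antisymm
  · rintro _ ⟨τ, rfl⟩
    rw [← sub_add_cancel (tensorToGlM p τ) (TensorProduct.lift p τ • elem p v w b b)]
    exact add_mem (Submodule.mem_sup_right (tensorToGlM_sub_smul_mem v w (sl p) b
      (fun _ _ => elem_mem_sl hp) (fun a => elem_sub_elem_mem_sl hp a b) hp τ))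
      (Submodule.mem_sup_left (Submodule.smul_mem _ _ (Submodule.mem_span_singleton_self _)))
  · rw [sup_le_iff, Submodule.span_singleton_le_iff_mem]
    exact ⟨⟨_, rfl⟩, by rintro _ ⟨τ, -, rfl⟩; exact ⟨τ, rfl⟩⟩

/-- A tensor is recovered from the matrix of its operator, so the trace of an operator in `gl(V, W)`
is well defined; this is what separates `e_{b,b}` from `sl`. -/
theorem repr_tensorProduct_apply (hp : IsDualPair p v w) (τ : V ⊗[ℂ] W) (a b : B) :
    (v.tensorProduct w).repr τ (a, b) = v.repr (tensorToEnd p τ (v b)) a := by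
  induction τ with
  | zero => simp
  | add x y hx hy => simp [hx, hy]
  | tmul x y => simp [tensorToEnd_tmul, hp.apply_left, mul_comm]

theorem tensorToGlM_injective (hp : IsDualPair p v w) : Function.Injective (tensorToGlM p) := by
  rw [← LinearMap.ker_eq_bot, LinearMap.ker_eq_bot']
  intro τ hτ
  have hτ' : tensorToEnd p τ = 0 := congrArg Subtype.val hτ
  refine (v.tensorProduct w).repr.map_eq_zero_iff.1 (Finsupp.ext fun ⟨a, b⟩ => ?_)
  simp [repr_tensorProduct_apply hp, hτ']

theorem elem_self_notMem_sl (hp : IsDualPair p v w) (b : B) : elem p v w b b ∉ sl p := by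
  rintro ⟨τ, hτ, h⟩
  rw [tensorToGlM_injective hp h] at hτ
  simp [hp.apply_right] at hτ

theorem glMFilt_zero (hp : IsDualPair p v w) : glMFilt p v 0 = glFin p := by
  ext φ
  rw [hp.mem_glMFilt_iff, Nat.cast_zero, Cardinal.aleph_zero, Cardinal.lt_aleph0_iff_set_finite]
  constructor
  · intro h
    refine ⟨∑ b ∈ h.toFinset, (φ : Module.End ℂ V) (v b) ⊗ₜ w b, Subtype.ext (v.ext fun b => ?_)⟩
    change tensorToEnd p _ (v b) = _
    rw [map_sum, LinearMap.sum_apply, Finset.sum_eq_single b]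
    · simp [tensorToEnd_tmul, hp.apply_right]
    · intro c _ hc
      simp [tensorToEnd_tmul, hp.apply_right, hc.symm]
    · intro hb
      have : (φ : Module.End ℂ V) (v b) = 0 := by simpa [mem_colSupp] using hb
      simp [this]
  · rintro ⟨τ, rfl⟩
    change (colSupp v (tensorToEnd p τ)).Finite
    induction τ with
    | zero => simp [colSupp]
    | add x y hx hy =>
      refine (hx.union hy).subset fun b hb => ?_
      by_contra h
      simp only [Set.mem_union, mem_colSupp, not_or, not_not] at h
      exact hb (by simp [h.1, h.2])
    | tmul x y =>
      refine (w.repr y).hasFiniteSupport.subset fun b hb h => hb ?_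
      rw [tensorToEnd_tmul, hp.apply_left, h, zero_smul]

theorem exists_sub_smul_one_ne_zero {U : Submodule ℂ (glM p)} (h : ¬ U ≤ scalars p) :
    ∃ φ ∈ U, ∀ c : ℂ, (φ : Module.End ℂ V) - c • 1 ≠ 0 := by
  obtain ⟨φ, hφU, hφ⟩ := SetLike.not_le_iff_exists.1 h
  refine ⟨φ, hφU, fun c hc => hφ (Submodule.mem_span_singleton.2 ⟨c, Subtype.ext ?_⟩)⟩
  exact (sub_eq_zero.1 hc).symm

/-- The case `κ = 1` of the main containment: small means zero, and elementary matrices have one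
nonzero column. Their brackets span `sl`. -/
theorem sl_le_of_not_le (hp : IsDualPair p v w) [Nonempty B] {U : Submodule ℂ (glM p)}
    (hU : IsIdeal U) (h : ¬ U ≤ scalars p) : sl p ≤ U := by
  obtain ⟨φ, hφU, hφ⟩ := exists_sub_smul_one_ne_zero h
  have hlie : ∀ a b c d, ⁅elem p v w a b, elem p v w c d⁆ ∈ U := by
    intro a b c d
    have h1 : IsThreshold (1 : Cardinal.{u}) := Or.inl rfl
    have hφ1 : ∀ c : ℂ, (φ : Module.End ℂ V) - c • 1 ∉ smallOps v h1 := by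
      intro c hc
      have h0 := hc.2
      rw [Cardinal.lt_one_iff, Cardinal.mk_set_eq_zero_iff] at h0
      refine hφ c (v.ext fun b => ?_)
      by_contra hb
      exact (h0 ▸ Set.notMem_empty b) hb
    have hsub : colSupp v (elem p v w a b : Module.End ℂ V) ⊆ {b} := by
      intro b' hb'
      by_contra hne
      exact hb' (by simp [elem_apply hp, show b' ≠ b from hne])
    obtain ⟨x, hx, hx'⟩ := (hp.isLieIdealOf hU).comm_mem h1
      (Cardinal.one_le_iff_ne_zero.2 (Cardinal.mk_ne_zero B)) ⟨φ, hφU, rfl⟩ hφ1 (hp.coe_mem _)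
      ((Cardinal.mk_le_mk_of_subset hsub).trans (Cardinal.mk_singleton b).le)
      (hp.coe_mem (elem p v w c d))
    rwa [show x = ⁅elem p v w a b, elem p v w c d⁆ from Subtype.ext hx'] at hx
  obtain ⟨b₀⟩ := ‹Nonempty B›
  rintro _ ⟨τ, hτ, rfl⟩
  have := tensorToGlM_sub_smul_mem v w U b₀
    (fun a b hab => elem_lie_elem_of_ne hp hab ▸ hlie a b b b)
    (fun a => elem_lie_elem_swap hp a b₀ ▸ hlie a b₀ b₀ a) hp τ
  rwa [show TensorProduct.lift p τ = 0 from hτ, zero_smul, sub_zero] at this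

theorem glMFilt_succ_le_of_not_le (hp : IsDualPair p v w) {U : Submodule ℂ (glM p)}
    (hU : IsIdeal U) {s : ℕ} (hs : ℵ_ s ≤ #B) (h : ¬ U ≤ scalars p ⊔ glMFilt p v s) :
    glMFilt p v (s + 1) ≤ U := by
  obtain ⟨φ, hφU, hφ⟩ := SetLike.not_le_iff_exists.1 h
  intro y hy
  -- Fewer than `ℵ_{s+1}` columns means at most `ℵ_s`, which is the bound in the main containment
  -- for `κ = ℵ_s`.
  rw [hp.mem_glMFilt_iff, Nat.cast_succ, ← Cardinal.succ_aleph,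
    Order.lt_succ_iff] at hy
  have hφs : ∀ c : ℂ, (φ : Module.End ℂ V) - c • 1 ∉ smallOps v (isThreshold_aleph s) := by
    intro c hc
    have hmem : φ - c • idM p ∈ glMFilt p v s := hp.mem_glMFilt_iff.2 hc.2
    apply hφ
    rw [← add_sub_cancel (c • idM p) φ]
    exact add_mem (Submodule.mem_sup_left
      (Submodule.smul_mem _ _ (Submodule.mem_span_singleton_self _))) (Submodule.mem_sup_right hmem)
  obtain ⟨x, hx, hxy⟩ := (hp.isLieIdealOf hU).mem_of_le (Cardinal.aleph0_le_aleph s) hs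
    ⟨φ, hφU, rfl⟩ hφs (hp.coe_mem y) hy
  rwa [show x = y from Subtype.ext hxy] at hx

end DualPair

/-! ### Socle layers through the covering relation on submodules -/

section SocleFiltration

variable {L M : Type*} [LieRing L] [AddCommGroup M] [Module ℂ M] [LieRingModule L M]

/-- The submodules of a submodule `N` are the submodules below `N`. -/
def lieSubmoduleOrderIsoIic (N : LieSubmodule ℂ L M) : LieSubmodule ℂ L N ≃o Set.Iic N where
  toFun S := ⟨S.map N.incl, by
    rintro _ ⟨x, -, rfl⟩
    exact x.2⟩
  invFun P := P.1.comap N.incl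
  left_inv S := by
    ext x
    simp [LieSubmodule.mem_map]
  right_inv P := Subtype.ext <| by
    ext x
    simp only [LieSubmodule.mem_map, LieSubmodule.mem_comap]
    exact ⟨fun ⟨y, hy, h⟩ => h ▸ hy, fun h => ⟨⟨x, P.2 h⟩, h, rfl⟩⟩
  map_rel_iff' {S T} := by
    refine ⟨fun h x hx => ?_, fun h => LieSubmodule.map_mono h⟩
    obtain ⟨y, hy, hyx⟩ := h (show (x : M) ∈ S.map N.incl from ⟨x, hx, rfl⟩)
    rwa [show y = x from Subtype.ext hyx] at hy

theorem isIrreducible_iff_isAtom (N : LieSubmodule ℂ L M) :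
    LieModule.IsIrreducible ℂ L N ↔ IsAtom N := by
  rw [LieModule.IsIrreducible, (lieSubmoduleOrderIsoIic N).isSimpleOrder_iff,
    Set.isSimpleOrder_Iic_iff_isAtom]

variable [LieAlgebra ℂ L] [LieModule ℂ L M]

/-- The submodules of a quotient `M / N` are the submodules above `N`. -/
def lieSubmoduleQuotientOrderIsoIci (N : LieSubmodule ℂ L M) :
    LieSubmodule ℂ L (M ⧸ N) ≃o Set.Ici N where
  toFun S := ⟨S.comap (LieSubmodule.Quotient.mk' N), fun x hx => by
    rw [LieSubmodule.mem_comap, (LieSubmodule.Quotient.mk_eq_zero N).2 hx]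
    exact zero_mem S⟩
  invFun P := P.1.map (LieSubmodule.Quotient.mk' N)
  left_inv S := by
    ext x
    obtain ⟨x, rfl⟩ := LieSubmodule.Quotient.surjective_mk' N x
    simp only [LieSubmodule.mem_map, LieSubmodule.mem_comap]
    exact ⟨fun ⟨y, hy, h⟩ => h ▸ hy, fun h => ⟨x, h, rfl⟩⟩
  right_inv P := Subtype.ext <| by
    ext x
    simp only [LieSubmodule.mem_map, LieSubmodule.mem_comap]
    refine ⟨fun ⟨y, hy, h⟩ => ?_, fun h => ⟨x, h, rfl⟩⟩
    have hxy : x - y ∈ N := by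
      rw [← LieSubmodule.Quotient.mk_eq_zero, map_sub, h, sub_self]
    rw [← sub_add_cancel x y]
    exact add_mem (P.2 hxy) hy
  map_rel_iff' {S T} := by
    refine ⟨fun h x hx => ?_, fun h x hx => h hx⟩
    obtain ⟨x, rfl⟩ := LieSubmodule.Quotient.surjective_mk' N x
    exact h (show x ∈ S.comap _ from hx)

theorem comap_socle_quotient (N : LieSubmodule ℂ L M) :
    (socle L (M ⧸ N)).comap (LieSubmodule.Quotient.mk' N) = N ⊔ sSup {P | N ⋖ P} := by
  set e := lieSubmoduleQuotientOrderIsoIci N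
  set T : LieSubmodule ℂ L M := N ⊔ sSup {P | N ⋖ P} with hT
  have hNT : N ≤ T := le_sup_left
  apply le_antisymm
  · have h : ∀ S ∈ {S : LieSubmodule ℂ L (M ⧸ N) | LieModule.IsIrreducible ℂ L S},
        S ≤ e.symm ⟨T, hNT⟩ := by
      intro S hS
      have hS : IsAtom S := (isIrreducible_iff_isAtom S).1 hS
      have hcov : N ⋖ (e S).1 := (covBy_iff_atom_Ici (e S).2).2 ((e.isAtom_iff S).2 hS)
      have hle : (e S).1 ≤ T := (le_sSup (s := {P | N ⋖ P}) hcov).trans le_sup_right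
      exact e.le_symm_apply.2 hle
    have h' : socle L (M ⧸ N) ≤ e.symm ⟨T, hNT⟩ := sSup_le h
    exact e.le_symm_apply.1 h'
  · refine sup_le (e (socle L (M ⧸ N))).2 (sSup_le fun P hP => ?_)
    have hP : N ⋖ P := hP
    have hatom : IsAtom (e.symm ⟨P, hP.le⟩) :=
      (e.symm.isAtom_iff _).2 ((covBy_iff_atom_Ici hP.le).1 hP)
    have h : e.symm ⟨P, hP.le⟩ ≤ socle L (M ⧸ N) :=
      le_sSup ((isIrreducible_iff_isAtom _).2 hatom)
    exact e.symm_apply_le.1 h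

theorem soc_succ (q : ℕ) : soc L M (q + 1) = soc L M q ⊔ sSup {P | soc L M q ⋖ P} :=
  comap_socle_quotient _

theorem soc_succ_eq_of_forall_lt {q : ℕ} {N : LieSubmodule ℂ L M} (h : soc L M q < N)
    (h' : ∀ P, soc L M q < P → N ≤ P) : soc L M (q + 1) = N := by
  have hcov : {P | soc L M q ⋖ P} = {N} := by
    ext P
    refine ⟨fun hP => ?_, ?_⟩
    · by_contra hne
      exact hP.2 h (lt_of_le_of_ne (h' P hP.lt) (Ne.symm hne))
    · rintro rfl
      exact ⟨h, fun Q hQ hQP => absurd (h' Q hQ) (not_le_of_gt hQP)⟩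
  rw [soc_succ, hcov, sSup_singleton, sup_eq_right.2 h.le]

end SocleFiltration

/-! ### Classification of the ideals and computation of the socle filtration -/

section Classification

universe u

variable {V W : Type*} {B : Type u} [AddCommGroup V] [Module ℂ V] [AddCommGroup W] [Module ℂ W]
  {p : V →ₗ[ℂ] W →ₗ[ℂ] ℂ} {v : Module.Basis B ℂ V} {w : Module.Basis B ℂ W}

theorem mem_scalars {φ : glM p} : φ ∈ scalars p ↔ ∃ c : ℂ, c • idM p = φ :=
  Submodule.mem_span_singleton

theorem lie_smul_idM (a : glM p) (c : ℂ) : ⁅a, c • idM p⁆ = 0 := by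
  rw [lie_smul]
  refine smul_eq_zero_of_right c (Subtype.ext ?_)
  change (a : Module.End ℂ V) * 1 - 1 * (a : Module.End ℂ V) = 0
  simp

/-- `[a, x ⊗ y] = a x ⊗ y - x ⊗ a^* y`, whose two terms have equal trace. Hence every subspace
between `sl` and `ℂ id + gl` is an ideal. -/
theorem lie_mem_sl (a x : glM p) (hx : x ∈ glFin p) : ⁅a, x⁆ ∈ sl p := by
  obtain ⟨τ, rfl⟩ := hx
  induction τ with
  | zero => simp
  | add x y hx hy => rw [map_add, lie_add]; exact add_mem hx hy
  | tmul x y =>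
    obtain ⟨y', hy'⟩ := a.2 ⟨_, ⟨y, rfl⟩, rfl⟩
    have hy' : ∀ u, p u y' = p ((a : Module.End ℂ V) u) y := LinearMap.congr_fun hy'
    refine ⟨(a : Module.End ℂ V) x ⊗ₜ y - x ⊗ₜ y', by simp [hy'], ?_⟩
    refine Subtype.ext (LinearMap.ext fun u => ?_)
    rw [map_sub]
    change tensorToEnd p ((a : Module.End ℂ V) x ⊗ₜ y) u - tensorToEnd p (x ⊗ₜ y') u
      = (a : Module.End ℂ V) (tensorToEnd p (x ⊗ₜ y) u)
        - tensorToEnd p (x ⊗ₜ y) ((a : Module.End ℂ V) u)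
    simp [tensorToEnd_tmul, hy']

theorem sl_le_glFin : sl p ≤ glFin p := by
  rintro _ ⟨τ, -, rfl⟩
  exact ⟨τ, rfl⟩

theorem isIdeal_scalars : IsIdeal (scalars p) := by
  refine isIdeal_iff.2 fun a x hx => ?_
  obtain ⟨c, rfl⟩ := mem_scalars.1 hx
  rw [lie_smul_idM]
  exact zero_mem _

theorem isIdeal_of_sl_le {U : Submodule ℂ (glM p)} (h : sl p ≤ U) (h' : U ≤ scalars p ⊔ glFin p) :
    IsIdeal U := by
  refine isIdeal_iff.2 fun a x hx => ?_
  obtain ⟨y, hy, z, hz, rfl⟩ := Submodule.mem_sup.1 (h' hx)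
  obtain ⟨c, rfl⟩ := mem_scalars.1 hy
  rw [lie_add, lie_smul_idM, zero_add]
  exact h (lie_mem_sl a z hz)

theorem isIdeal_glMFilt (hp : IsDualPair p v w) (s : ℕ) : IsIdeal (glMFilt p v s) := by
  refine isIdeal_iff.2 fun a x hx => ?_
  have hx' : (x : Module.End ℂ V) ∈ smallOps v (isThreshold_aleph s) :=
    ⟨hp.coe_mem x, hp.mem_glMFilt_iff.1 hx⟩
  exact hp.mem_glMFilt_iff.2 (sub_mem (mul_mem_smallOps_left _ (hp.coe_mem a) hx')
    (mul_mem_smallOps_right _ (hp.coe_mem a) hx')).2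

theorem glMFilt_mono (hp : IsDualPair p v w) {s s' : ℕ} (h : s ≤ s') :
    glMFilt p v s ≤ glMFilt p v s' := fun φ hφ => by
  rw [hp.mem_glMFilt_iff] at hφ ⊢
  exact hφ.trans_le (Cardinal.aleph_le_aleph.2 (by exact_mod_cast h))

theorem sl_le_glMFilt (hp : IsDualPair p v w) (s : ℕ) : sl p ≤ glMFilt p v s :=
  sl_le_glFin.trans ((glMFilt_zero hp).symm.le.trans (glMFilt_mono hp (Nat.zero_le s)))

theorem glMFilt_succ_eq_top (hp : IsDualPair p v w) {t : ℕ} (hB : #B = ℵ_ t) :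
    glMFilt p v (t + 1) = ⊤ := by
  refine eq_top_iff.2 fun φ _ => hp.mem_glMFilt_iff.2 ((Cardinal.mk_set_le _).trans_lt ?_)
  rw [hB, Cardinal.aleph_lt_aleph]
  exact_mod_cast Nat.lt_succ_self t

theorem eq_zero_of_smul_idM_mem (hp : IsDualPair p v w) {s : ℕ} (hs : ℵ_ s ≤ #B) {c : ℂ}
    (h : c • idM p ∈ glMFilt p v s) : c = 0 := by
  by_contra hc
  rw [hp.mem_glMFilt_iff] at h
  refine absurd h (not_lt.2 (hs.trans ?_))
  rw [← Cardinal.mk_univ]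
  refine Cardinal.mk_le_mk_of_subset fun b _ => ?_
  change c • v b ≠ 0
  exact smul_ne_zero hc (v.ne_zero b)

theorem disjoint_scalars_glMFilt (hp : IsDualPair p v w) {s : ℕ} (hs : ℵ_ s ≤ #B) :
    Disjoint (scalars p) (glMFilt p v s) := by
  rw [Submodule.disjoint_def]
  intro x hx hx'
  obtain ⟨c, rfl⟩ := mem_scalars.1 hx
  rw [eq_zero_of_smul_idM_mem hp hs hx', zero_smul]

theorem exists_mk_eq_and_le_mk_compl {s : Ordinal.{u}} (hs : ℵ_ s ≤ #B) :
    ∃ S : Set B, #S = ℵ_ s ∧ ℵ_ s ≤ #(Sᶜ : Set B) := by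
  have hB : ℵ₀ ≤ #B := (Cardinal.aleph0_le_aleph s).trans hs
  obtain ⟨e⟩ := Cardinal.eq.1 (show #(B ⊕ B) = #B by simp [Cardinal.add_eq_self hB])
  obtain ⟨T, hT⟩ := Cardinal.le_mk_iff_exists_set.1 hs
  have hl : (fun b => e (Sum.inl b)).Injective := e.injective.comp Sum.inl_injective
  have hr : (fun b => e (Sum.inr b)).Injective := e.injective.comp Sum.inr_injective
  refine ⟨(fun b => e (Sum.inl b)) '' T, (Cardinal.mk_image_eq hl).trans hT,
    (hs.trans_eq (Cardinal.mk_range_eq _ hr).symm).trans (Cardinal.mk_le_mk_of_subset ?_)⟩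
  rintro _ ⟨b, rfl⟩ ⟨b', -, h⟩
  simp at h

/-- The witness is a projection to a set `S` of size `ℵ_s` with complement at least as large:
subtracting `c id` leaves the columns in `S` if `c = 0`, and those outside `S` otherwise. -/
theorem glMFilt_succ_not_le (hp : IsDualPair p v w) {s : ℕ} (hs : ℵ_ s ≤ #B) :
    ¬ glMFilt p v (s + 1) ≤ scalars p ⊔ glMFilt p v s := by
  obtain ⟨S, hS, hSc⟩ := exists_mk_eq_and_le_mk_compl hs
  intro h
  let P : glM p := ⟨projOp v S, hp.mem_glM_iff.2 (projOp_mem S)⟩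
  have hP : P ∈ glMFilt p v (s + 1) := by
    rw [hp.mem_glMFilt_iff, colSupp_projOp, hS, Cardinal.aleph_lt_aleph]
    exact_mod_cast Nat.lt_succ_self s
  obtain ⟨x, hx, y, hy, hxy⟩ := Submodule.mem_sup.1 (h hP)
  obtain ⟨c, rfl⟩ := mem_scalars.1 hx
  rw [hp.mem_glMFilt_iff] at hy
  have hyb : ∀ b, (y : Module.End ℂ V) (v b) = projOp v S (v b) - c • v b := fun b => by
    have : y = P - c • idM p := by rw [← hxy, add_sub_cancel_left]
    rw [this]
    rfl
  refine absurd hy (not_lt.2 ?_)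
  by_cases hc : c = 0
  · rw [← hS]
    refine Cardinal.mk_le_mk_of_subset fun b hb => ?_
    rw [mem_colSupp, hyb, projOp_apply_of_mem hb, hc, zero_smul, sub_zero]
    exact v.ne_zero b
  · refine hSc.trans (Cardinal.mk_le_mk_of_subset fun b hb => ?_)
    rw [mem_colSupp, hyb, projOp_apply_of_notMem hb, zero_sub, neg_ne_zero]
    exact smul_ne_zero hc (v.ne_zero b)

theorem scalars_sup_glMFilt_ne_top (hp : IsDualPair p v w) {s : ℕ} (hs : ℵ_ s ≤ #B) :
    scalars p ⊔ glMFilt p v s ≠ ⊤ := fun h =>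
  glMFilt_succ_not_le hp hs (h ▸ le_top)

theorem eq_or_eq_span_sup {E : Type*} [AddCommGroup E] [Module ℂ E] {N U : Submodule ℂ E} {x : E}
    (h : N ≤ U) (h' : U ≤ Submodule.span ℂ {x} ⊔ N) : U = N ∨ U = Submodule.span ℂ {x} ⊔ N := by
  by_cases hU : U ≤ N
  · exact Or.inl (le_antisymm hU h)
  refine Or.inr (le_antisymm h' (sup_le ((Submodule.span_singleton_le_iff_mem _ _).2 ?_) h))
  obtain ⟨y, hyU, hy⟩ := SetLike.not_le_iff_exists.1 hU
  obtain ⟨z, hz, n, hn, rfl⟩ := Submodule.mem_sup.1 (h' hyU)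
  obtain ⟨c, rfl⟩ := Submodule.mem_span_singleton.1 hz
  have hc : c ≠ 0 := by
    rintro rfl
    exact hy (by simpa using hn)
  have := U.smul_mem c⁻¹ (sub_mem hyU (h hn))
  rwa [add_sub_cancel_right, inv_smul_smul₀ hc] at this

variable (v w) in
-- The quotient by `sl` is spanned by `id` and `e_{b,b}`. A subspace not inside `gl` contains some
-- `id + r e_{b,b}`; the line it spans gives `ℂ id + sl` if `r = 0`, and the parameter `z = r⁻¹`
-- otherwise.
theorem eq_of_le_scalars_sup_glFin (hp : IsDualPair p v w) (b : B) {U : Submodule ℂ (glM p)}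
    (h : sl p ≤ U) (h' : U ≤ scalars p ⊔ glFin p) :
    U = sl p ∨ U = scalars p ⊔ sl p ∨ (∃ z : ℂ, z ≠ 0 ∧ U = slExt p v w z b) ∨
      U = glFin p ∨ U = scalars p ⊔ glFin p := by
  rw [glFin_eq_sup hp b] at h' ⊢
  by_cases hU : U ≤ Submodule.span ℂ {elem p v w b b} ⊔ sl p
  · rcases eq_or_eq_span_sup h hU with h | h <;> simp [h]
  obtain ⟨y, hyU, hy⟩ := SetLike.not_le_iff_exists.1 hU
  obtain ⟨x, hx, n, hn, rfl⟩ := Submodule.mem_sup.1 (h' hyU)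
  obtain ⟨c, rfl⟩ := mem_scalars.1 hx
  obtain ⟨x, hx, n, hn', rfl⟩ := Submodule.mem_sup.1 hn
  obtain ⟨d, rfl⟩ := Submodule.mem_span_singleton.1 hx
  have hc : c ≠ 0 := by
    rintro rfl
    exact hy (by simpa using hn)
  have hmem : idM p + (c⁻¹ * d) • elem p v w b b ∈ U := by
    have := U.smul_mem c⁻¹ (sub_mem hyU (h hn'))
    rwa [← add_assoc, add_sub_cancel_right, smul_add, inv_smul_smul₀ hc, smul_smul] at this
  set r := c⁻¹ * d
  have hle : Submodule.span ℂ {idM p + r • elem p v w b b} ⊔ sl p ≤ U :=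
    sup_le ((Submodule.span_singleton_le_iff_mem _ _).2 hmem) h
  have htop : scalars p ⊔ (Submodule.span ℂ {elem p v w b b} ⊔ sl p) =
      Submodule.span ℂ {elem p v w b b}
        ⊔ (Submodule.span ℂ {idM p + r • elem p v w b b} ⊔ sl p) := by
    simp only [scalars, ← sup_assoc, ← Submodule.span_union, Set.singleton_union]
    congr 1
    refine Submodule.span_eq_span ?_ ?_ <;> rw [Set.pair_subset_iff]
    · refine ⟨?_, Submodule.subset_span (by simp)⟩
      rw [SetLike.mem_coe, Submodule.mem_span_pair]
      exact ⟨-r, 1, by simp⟩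
    · refine ⟨Submodule.subset_span (by simp), ?_⟩
      rw [SetLike.mem_coe, Submodule.mem_span_pair]
      exact ⟨1, r, by simp⟩
  rcases eq_or_eq_span_sup hle (htop ▸ h') with hU' | hU'
  · by_cases hr : r = 0
    · right; left
      rw [hU', hr, zero_smul, add_zero]
      rfl
    · right; right; left
      refine ⟨r⁻¹, inv_ne_zero hr, ?_⟩
      rw [hU', slExt]
      congr 1
      rw [← Submodule.span_singleton_smul_eq (inv_ne_zero hr).isUnit, smul_add,
        inv_smul_smul₀ hr]
  · right; right; right; right
    rw [hU', htop]

theorem slExt_eq (hp : IsDualPair p v w) (z : ℂ) (b b' : B) :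
    slExt p v w z b = slExt p v w z b' := by
  have key : ∀ b b', slExt p v w z b ≤ slExt p v w z b' := by
    intro b b'
    refine sup_le ((Submodule.span_singleton_le_iff_mem _ _).2 ?_) le_sup_right
    rw [show z • idM p + elem p v w b b = (z • idM p + elem p v w b' b')
      + (elem p v w b b - elem p v w b' b') by abel]
    exact add_mem (Submodule.mem_sup_left (Submodule.mem_span_singleton_self _))
      (Submodule.mem_sup_right (elem_sub_elem_mem_sl hp b b'))
  exact le_antisymm (key b b') (key b' b)

theorem slExt_le (z : ℂ) (b : B) : slExt p v w z b ≤ scalars p ⊔ glFin p := by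
  refine sup_le ((Submodule.span_singleton_le_iff_mem _ _).2 ?_) (sl_le_glFin.trans le_sup_right)
  exact add_mem (Submodule.mem_sup_left (mem_scalars.2 ⟨z, rfl⟩))
    (Submodule.mem_sup_right ⟨_, rfl⟩)

theorem idM_ne_zero (v : Module.Basis B ℂ V) [Nonempty B] : idM p ≠ 0 := by
  obtain ⟨b⟩ := ‹Nonempty B›
  intro h
  exact v.ne_zero b (LinearMap.congr_fun (congrArg Subtype.val h) (v b))

theorem elem_ne_zero (hp : IsDualPair p v w) (a b : B) : elem p v w a b ≠ 0 := by
  intro h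
  have := elem_apply hp a b (v b)
  rw [h] at this
  exact v.ne_zero a (by simpa using this.symm)

theorem scalars_ne_bot (v : Module.Basis B ℂ V) [Nonempty B] : scalars p ≠ ⊥ := by
  rw [scalars, Ne, Submodule.span_singleton_eq_bot]
  exact idM_ne_zero v

theorem sl_ne_bot (hp : IsDualPair p v w) [Nontrivial B] : sl p ≠ ⊥ := by
  obtain ⟨a, b, hab⟩ := exists_pair_ne B
  exact (Submodule.ne_bot_iff _).2 ⟨_, elem_mem_sl hp hab, elem_ne_zero hp a b⟩

theorem eq_scalars_of_le {U : Submodule ℂ (glM p)} (hU : U ≠ ⊥) (h : U ≤ scalars p) :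
    U = scalars p := by
  have := eq_or_eq_span_sup (N := ⊥) (x := idM p) bot_le (by simpa [scalars] using h)
  simpa [hU, scalars] using this

theorem center_eq_scalars (hp : IsDualPair p v w) [Nontrivial B] :
    (LieAlgebra.center ℂ (glM p)).toSubmodule = scalars p := by
  apply le_antisymm
  · by_contra h
    obtain ⟨a, b, hab⟩ := exists_pair_ne B
    have hmem := sl_le_of_not_le hp ⟨_, rfl⟩ h (elem_mem_sl hp hab)
    have h0 : ⁅elem p v w b b, elem p v w a b⁆ = 0 := hmem (elem p v w b b)
    rw [← lie_skew, elem_lie_elem_of_ne hp hab, neg_eq_zero] at h0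
    exact elem_ne_zero hp a b h0
  · intro x hx
    obtain ⟨c, rfl⟩ := mem_scalars.1 hx
    exact fun a => lie_smul_idM a c

theorem eq_of_isIdeal (hp : IsDualPair p v w) {t : ℕ} (hB : #B = ℵ_ t) {U : Submodule ℂ (glM p)}
    (hU : IsIdeal U) (hbot : U ≠ ⊥) (htop : U ≠ ⊤) :
    U = scalars p ∨ U = sl p ∨ U = scalars p ⊔ sl p ∨
      (∃ (z : ℂ) (b : B), z ≠ 0 ∧ U = slExt p v w z b) ∨
      (∃ s ≤ t, U = glMFilt p v s) ∨ ∃ s ≤ t, U = scalars p ⊔ glMFilt p v s := by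
  have : Infinite B := Cardinal.infinite_iff.2 (hB ▸ Cardinal.aleph0_le_aleph t)
  by_cases h : U ≤ scalars p
  · exact Or.inl (eq_scalars_of_le hbot h)
  have hsl := sl_le_of_not_le hp hU h
  by_cases h0 : U ≤ scalars p ⊔ glMFilt p v 0
  · rw [glMFilt_zero hp] at h0
    obtain ⟨b⟩ : Nonempty B := inferInstance
    rcases eq_of_le_scalars_sup_glFin v w hp b hsl h0 with h | h | ⟨z, hz, h⟩ | h | h
    · exact Or.inr (Or.inl h)
    · exact Or.inr (Or.inr (Or.inl h))
    · exact Or.inr (Or.inr (Or.inr (Or.inl ⟨z, b, hz, h⟩)))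
    · exact Or.inr (Or.inr (Or.inr (Or.inr (Or.inl
        ⟨0, Nat.zero_le t, h.trans (glMFilt_zero hp).symm⟩))))
    · exact Or.inr (Or.inr (Or.inr (Or.inr (Or.inr
        ⟨0, Nat.zero_le t, by rw [h, glMFilt_zero hp]⟩))))
  -- The least such `s` is used; `t + 1` qualifies since `gl^M_{t+1}` is everything. It cannot be
  -- the least, as `U` would then contain `gl^M_{t+1}`.
  have hex : ∃ s, U ≤ scalars p ⊔ glMFilt p v s :=
    ⟨t + 1, by rw [glMFilt_succ_eq_top hp hB]; simp⟩
  classical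
  obtain ⟨s, hs⟩ := Nat.exists_eq_succ_of_ne_zero (fun h => h0 (h ▸ Nat.find_spec hex) :
    Nat.find hex ≠ 0)
  have hle := Nat.find_spec hex
  have hnot := Nat.find_min hex (show s < Nat.find hex by omega)
  rw [hs] at hle
  have hst : s < t + 1 := by
    by_contra! hst
    exact hnot (le_sup_of_le_right ((glMFilt_succ_eq_top hp hB ▸ le_top : U ≤ _).trans
      (glMFilt_mono hp hst)))
  have hlow := glMFilt_succ_le_of_not_le hp hU
    (hB ▸ Cardinal.aleph_le_aleph.2 (by exact_mod_cast Nat.lt_succ_iff.1 hst)) hnot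
  have hst' : s + 1 ≤ t := by
    rcases Nat.lt_or_eq_of_le (Nat.lt_succ_iff.1 hst) with h | rfl
    · exact h
    · rw [glMFilt_succ_eq_top hp hB] at hlow
      exact absurd (eq_top_iff.2 hlow) htop
  rcases eq_or_eq_span_sup hlow hle with h | h
  · exact Or.inr (Or.inr (Or.inr (Or.inr (Or.inl ⟨s + 1, hst', h⟩))))
  · exact Or.inr (Or.inr (Or.inr (Or.inr (Or.inr ⟨s + 1, hst', h⟩))))

theorem isIdeal_and_ne_of_eq (hp : IsDualPair p v w) {t : ℕ} (hB : #B = ℵ_ t)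
    {U : Submodule ℂ (glM p)}
    (h : U = scalars p ∨ U = sl p ∨ U = scalars p ⊔ sl p ∨
      (∃ (z : ℂ) (b : B), z ≠ 0 ∧ U = slExt p v w z b) ∨
      (∃ s ≤ t, U = glMFilt p v s) ∨ ∃ s ≤ t, U = scalars p ⊔ glMFilt p v s) :
    IsIdeal U ∧ U ≠ ⊥ ∧ U ≠ ⊤ := by
  have : Infinite B := Cardinal.infinite_iff.2 (hB ▸ Cardinal.aleph0_le_aleph t)
  have hsc : U ≤ scalars p ⊔ glMFilt p v t → U ≠ ⊤ := by
    rintro h rfl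
    exact scalars_sup_glMFilt_ne_top hp hB.symm.le (top_le_iff.1 h)
  have hfin : scalars p ⊔ glFin p ≤ scalars p ⊔ glMFilt p v t :=
    sup_le_sup_left ((glMFilt_zero hp).symm.le.trans (glMFilt_mono hp (Nat.zero_le t))) _
  rcases h with h | h | h | ⟨z, b, -, h⟩ | ⟨s, hs, h⟩ | ⟨s, hs, h⟩
  · exact ⟨h ▸ isIdeal_scalars, h ▸ scalars_ne_bot v, hsc (h ▸ le_sup_left)⟩
  · have hle : sl p ≤ scalars p ⊔ glFin p := sl_le_glFin.trans le_sup_right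
    exact ⟨h ▸ isIdeal_of_sl_le le_rfl hle, h ▸ sl_ne_bot hp, hsc (h ▸ hle.trans hfin)⟩
  · have hle : scalars p ⊔ sl p ≤ scalars p ⊔ glFin p := sup_le_sup_left sl_le_glFin _
    exact ⟨h ▸ isIdeal_of_sl_le le_sup_right hle,
      h ▸ ne_bot_of_le_ne_bot (sl_ne_bot hp) le_sup_right, hsc (h ▸ hle.trans hfin)⟩
  · exact ⟨h ▸ isIdeal_of_sl_le le_sup_right (slExt_le z b),
      h ▸ ne_bot_of_le_ne_bot (sl_ne_bot hp) le_sup_right, hsc (h ▸ (slExt_le z b).trans hfin)⟩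
  · exact ⟨h ▸ isIdeal_glMFilt hp s, h ▸ ne_bot_of_le_ne_bot (sl_ne_bot hp) (sl_le_glMFilt hp s),
      hsc (h ▸ (glMFilt_mono hp hs).trans le_sup_right)⟩
  · exact ⟨h ▸ isIdeal_scalars.sup (isIdeal_glMFilt hp s),
      h ▸ ne_bot_of_le_ne_bot (scalars_ne_bot v) le_sup_left,
      hsc (h ▸ sup_le_sup_left (glMFilt_mono hp hs) _)⟩

theorem aleph_le_mk {t s : ℕ} (hB : #B = ℵ_ t) (hs : s ≤ t) : ℵ_ s ≤ #B :=
  hB ▸ Cardinal.aleph_le_aleph.2 (by exact_mod_cast hs)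

theorem disjoint_scalars_sl (hp : IsDualPair p v w) [Infinite B] : Disjoint (scalars p) (sl p) :=
  (disjoint_scalars_glMFilt hp (s := 0) (by simp)).mono_right (sl_le_glMFilt hp 0)

theorem soc_one (hp : IsDualPair p v w) [Infinite B] :
    (soc (glM p) (glM p) 1).toSubmodule = scalars p ⊔ sl p := by
  obtain ⟨I, hI⟩ : IsIdeal (scalars p) := isIdeal_scalars
  obtain ⟨K, hK⟩ : IsIdeal (sl p) := isIdeal_of_sl_le le_rfl (sl_le_glFin.trans le_sup_right)
  have hatoms : {P : LieSubmodule ℂ (glM p) (glM p) | IsAtom P} = {I, K} := by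
    have hI0 : I ≠ ⊥ := fun h => scalars_ne_bot v (by rw [← hI, h]; rfl)
    have hK0 : K ≠ ⊥ := fun h => sl_ne_bot hp (by rw [← hK, h]; rfl)
    have hle : ∀ P : LieSubmodule ℂ (glM p) (glM p), ¬ P ≤ I → K ≤ P := fun P h => by
      have : ¬ P.toSubmodule ≤ scalars p := by rwa [← hI]
      have := sl_le_of_not_le hp ⟨P, rfl⟩ this
      rwa [← hK] at this
    have hIeq : ∀ P : LieSubmodule ℂ (glM p) (glM p), P ≠ ⊥ → P ≤ I → P = I := fun P h h' => by
      apply LieSubmodule.toSubmodule_injective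
      rw [hI]
      exact eq_scalars_of_le (by simpa using h) (hI ▸ h')
    ext P
    refine ⟨fun hP => ?_, ?_⟩
    · by_cases h : P ≤ I
      · exact Or.inl (hIeq P hP.1 h)
      · exact Or.inr ((hP.le_iff_eq hK0).1 (hle P h)).symm
    · rintro (rfl | rfl)
      · exact ⟨hI0, fun Q hQ => by_contra fun hQ0 => hQ.ne (hIeq Q hQ0 hQ.le)⟩
      · refine ⟨hK0, fun Q hQ => by_contra fun hQ0 => ?_⟩
        -- A `Q` strictly inside `sl` is zero if it consists of scalars, and otherwise would contain
        -- `sl`.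
        by_cases h : Q ≤ I
        · have hd := (disjoint_scalars_sl hp).mono (hI ▸ h : Q.toSubmodule ≤ _) ((show Q.toSubmodule ≤ P.toSubmodule from hQ.le).trans hK.le)
          exact hQ0 (by simpa using disjoint_self.1 hd)
        · exact hQ.not_ge (hle Q h)
  rw [soc_succ, soc, bot_sup_eq]
  simp only [bot_covBy_iff]
  rw [hatoms, sSup_pair, LieSubmodule.sup_toSubmodule, hI, hK]

theorem soc_succ_succ (hp : IsDualPair p v w) {t : ℕ} (hB : #B = ℵ_ t) {s : ℕ} (hs : s ≤ t) :
    (soc (glM p) (glM p) (s + 2)).toSubmodule = scalars p ⊔ glMFilt p v s := by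
  have : Infinite B := Cardinal.infinite_iff.2 (hB ▸ Cardinal.aleph0_le_aleph t)
  induction s with
  | zero =>
    obtain ⟨N, hN⟩ : IsIdeal (scalars p ⊔ glMFilt p v 0) :=
      isIdeal_scalars.sup (isIdeal_glMFilt hp 0)
    obtain ⟨b⟩ : Nonempty B := inferInstance
    rw [← hN, soc_succ_eq_of_forall_lt (q := 1) (N := N)]
    · refine lt_of_le_of_ne ?_ fun h => ?_
      · change (soc (glM p) (glM p) 1).toSubmodule ≤ N.toSubmodule
        rw [hN, soc_one hp]
        exact sup_le_sup_left (sl_le_glMFilt hp 0) _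
      · have hmem : elem p v w b b ∈ scalars p ⊔ sl p := by
          rw [← soc_one hp, h, hN, glMFilt_zero hp]
          exact Submodule.mem_sup_right ⟨_, rfl⟩
        obtain ⟨x, hx, y, hy, hxy⟩ := Submodule.mem_sup.1 hmem
        have hx0 : x = 0 := by
          refine Submodule.disjoint_def.1 (disjoint_scalars_glMFilt hp (aleph_le_mk hB hs)) x hx ?_
          rw [show x = elem p v w b b - y from eq_sub_of_add_eq hxy, glMFilt_zero hp]
          exact sub_mem ⟨_, rfl⟩ (sl_le_glFin hy)
        rw [hx0, zero_add] at hxy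
        exact elem_self_notMem_sl hp b (hxy ▸ hy)
    · intro P hP
      have hle : scalars p ⊔ sl p ≤ P.toSubmodule := soc_one hp ▸ hP.le
      have hne : P.toSubmodule ≠ scalars p ⊔ sl p := fun h =>
        hP.ne (LieSubmodule.toSubmodule_injective ((soc_one hp).trans h.symm))
      change N.toSubmodule ≤ P.toSubmodule
      rw [hN]
      -- Inside `ℂ id + gl` the previous layer `ℂ id + sl` has codimension at most one; outside, `P`
      -- already contains `gl^M_1`.
      by_cases h : P.toSubmodule ≤ scalars p ⊔ glMFilt p v 0
      · rw [glMFilt_zero hp, glFin_eq_sup hp b, sup_left_comm] at h ⊢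
        exact ((eq_or_eq_span_sup hle h).resolve_left hne).ge
      · have h1 := glMFilt_succ_le_of_not_le hp ⟨P, rfl⟩ (aleph_le_mk hB hs) h
        exact sup_le (le_sup_left.trans hle) ((glMFilt_mono hp (Nat.zero_le 1)).trans h1)
  | succ s ih =>
    have ih := ih (Nat.le_of_succ_le hs)
    obtain ⟨N, hN⟩ : IsIdeal (scalars p ⊔ glMFilt p v (s + 1)) :=
      isIdeal_scalars.sup (isIdeal_glMFilt hp (s + 1))
    have hs' := aleph_le_mk hB (Nat.le_of_succ_le hs)
    rw [← hN, soc_succ_eq_of_forall_lt (q := s + 2) (N := N)]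
    · refine lt_of_le_not_ge ?_ fun h => ?_
      · change (soc (glM p) (glM p) (s + 2)).toSubmodule ≤ N.toSubmodule
        rw [hN, ih]
        exact sup_le_sup_left (glMFilt_mono hp (Nat.le_succ s)) _
      · have h : N.toSubmodule ≤ (soc (glM p) (glM p) (s + 2)).toSubmodule := h
        rw [hN, ih] at h
        exact glMFilt_succ_not_le hp hs' (le_sup_right.trans h)
    · intro P hP
      have hle : scalars p ⊔ glMFilt p v s ≤ P.toSubmodule := ih ▸ hP.le
      change N.toSubmodule ≤ P.toSubmodule
      rw [hN]
      refine sup_le (le_sup_left.trans hle) (glMFilt_succ_le_of_not_le hp ⟨P, rfl⟩ hs' fun h => ?_)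
      exact hP.ne (LieSubmodule.toSubmodule_injective (ih.trans (le_antisymm hle h)))

theorem isIdeal_le_glMFilt_iff (hp : IsDualPair p v w) {t : ℕ} (hB : #B = ℵ_ t)
    (U : Submodule ℂ (glM p)) :
    (IsIdeal U ∧ U ≠ ⊥ ∧ U ≤ glMFilt p v t) ↔ (U = sl p ∨ ∃ s ≤ t, U = glMFilt p v s) := by
  have hid : ¬ scalars p ≤ glMFilt p v t := fun h => one_ne_zero (α := ℂ)
    (eq_zero_of_smul_idM_mem hp hB.symm.le (h (mem_scalars.2 ⟨1, rfl⟩)))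
  constructor
  · rintro ⟨hU, hbot, hle⟩
    have htop : U ≠ ⊤ := fun h => hid (le_top.trans (h ▸ hle))
    rcases eq_of_isIdeal hp hB hU hbot htop with h | h | h | ⟨z, b, hz, h⟩ | h | ⟨s, -, h⟩
    · exact absurd (h ▸ hle) hid
    · exact Or.inl h
    · exact absurd (le_sup_left.trans (h ▸ hle)) hid
    · have hmem : z • idM p + elem p v w b b ∈ glMFilt p v t :=
        hle (h ▸ Submodule.mem_sup_left (Submodule.mem_span_singleton_self _))
      have he : elem p v w b b ∈ glMFilt p v t :=
        glMFilt_mono hp (Nat.zero_le t) (glMFilt_zero hp ▸ ⟨_, rfl⟩)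
      have := sub_mem hmem he
      rw [add_sub_cancel_right] at this
      exact absurd (eq_zero_of_smul_idM_mem hp hB.symm.le this) hz
    · exact Or.inr h
    · exact absurd (le_sup_left.trans (h ▸ hle)) hid
  · rintro (h | ⟨s, hs, h⟩)
    · have := isIdeal_and_ne_of_eq hp hB (Or.inr (Or.inl h))
      exact ⟨this.1, this.2.1, h ▸ sl_le_glMFilt hp t⟩
    · have := isIdeal_and_ne_of_eq hp hB (Or.inr (Or.inr (Or.inr (Or.inr (Or.inl ⟨s, hs, h⟩)))))
      exact ⟨this.1, this.2.1, h ▸ glMFilt_mono hp hs⟩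

theorem isIdeal_glMFilt_lt_iff (hp : IsDualPair p v w) {t : ℕ} (hB : #B = ℵ_ t)
    (U : Submodule ℂ (glM p)) :
    (IsIdeal U ∧ U ≠ ⊤ ∧ glMFilt p v t < U) ↔ U = scalars p ⊔ glMFilt p v t := by
  constructor
  · rintro ⟨hU, htop, hlt⟩
    have hle : U ≤ scalars p ⊔ glMFilt p v t := by
      by_contra h
      have := glMFilt_succ_le_of_not_le hp hU hB.symm.le h
      rw [glMFilt_succ_eq_top hp hB] at this
      exact htop (top_le_iff.1 this)
    exact (eq_or_eq_span_sup hlt.le hle).resolve_left hlt.ne'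
  · intro h
    have := isIdeal_and_ne_of_eq hp hB
      (Or.inr (Or.inr (Or.inr (Or.inr (Or.inr ⟨t, le_rfl, h⟩)))))
    refine ⟨this.1, this.2.2, h ▸ lt_of_le_not_ge le_sup_right fun hle => one_ne_zero (α := ℂ)
      (eq_zero_of_smul_idM_mem hp hB.symm.le (hle (Submodule.mem_sup_left ?_)))⟩
    exact mem_scalars.2 ⟨1, rfl⟩

end Classification

end Mackey

end

theorem mainTheorem8 {V W B : Type*} [AddCommGroup V] [Module ℂ V] [AddCommGroup W] [Module ℂ W]
    (p : V →ₗ[ℂ] W →ₗ[ℂ] ℂ) (v : Module.Basis B ℂ V) (w : Module.Basis B ℂ W)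
    (hp : Mackey.IsDualPair p v w) (t : ℕ) (ht : Module.rank ℂ V = ℵ_ t) :
    -- the complete list of nonzero proper ideals
    (∀ U : Submodule ℂ (Mackey.glM p),
      (Mackey.IsIdeal U ∧ U ≠ ⊥ ∧ U ≠ ⊤) ↔
        (U = Mackey.scalars p ∨
          U = Mackey.sl p ∨
          U = Mackey.scalars p ⊔ Mackey.sl p ∨
          (∃ (z : ℂ) (b : B), z ≠ 0 ∧ U = Mackey.slExt p v w z b) ∨
          (∃ s ≤ t, U = Mackey.glMFilt p v s) ∨
          (∃ s ≤ t, U = Mackey.scalars p ⊔ Mackey.glMFilt p v s))) ∧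
    -- the further assertions about the ideals of the list
    (LieAlgebra.center ℂ (Mackey.glM p)).toSubmodule = Mackey.scalars p ∧
    Disjoint (Mackey.scalars p) (Mackey.sl p) ∧
    Mackey.scalars p ⊔ Mackey.sl p
      = (Mackey.soc (Mackey.glM p) (Mackey.glM p) 1).toSubmodule ∧
    (∀ z : ℂ, z ≠ 0 → ∀ b b' : B, Mackey.slExt p v w z b = Mackey.slExt p v w z b') ∧
    (∀ z : ℂ, z ≠ 0 → ∀ b : B, Mackey.slExt p v w z b
      ≤ (Mackey.soc (Mackey.glM p) (Mackey.glM p) 2).toSubmodule) ∧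
    Mackey.glMFilt p v 0 = Mackey.glFin p ∧
    (∀ s ≤ t, Mackey.glMFilt p v s
      ≤ (Mackey.soc (Mackey.glM p) (Mackey.glM p) (s + 2)).toSubmodule) ∧
    (∀ s ≤ t, Disjoint (Mackey.scalars p) (Mackey.glMFilt p v s)) ∧
    (∀ s ≤ t, Mackey.scalars p ⊔ Mackey.glMFilt p v s
      = (Mackey.soc (Mackey.glM p) (Mackey.glM p) (s + 2)).toSubmodule) ∧
    -- the nonzero ideals contained in `gl^M_t`
    (∀ U : Submodule ℂ (Mackey.glM p),
      (Mackey.IsIdeal U ∧ U ≠ ⊥ ∧ U ≤ Mackey.glMFilt p v t) ↔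
        (U = Mackey.sl p ∨ ∃ s ≤ t, U = Mackey.glMFilt p v s)) ∧
    -- the proper ideals strictly containing `gl^M_t`
    (∀ U : Submodule ℂ (Mackey.glM p),
      (Mackey.IsIdeal U ∧ U ≠ ⊤ ∧ Mackey.glMFilt p v t < U) ↔
        U = Mackey.scalars p ⊔ Mackey.glMFilt p v t) := by
  have hB : #B = ℵ_ t := by
    have h := v.mk_eq_rank
    rw [ht] at h
    simpa using h
  have : Infinite B := Cardinal.infinite_iff.2 (hB ▸ Cardinal.aleph0_le_aleph t)
  refine ⟨fun U => ⟨fun ⟨h, h', h''⟩ => Mackey.eq_of_isIdeal hp hB h h' h'',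
      Mackey.isIdeal_and_ne_of_eq hp hB⟩,
    Mackey.center_eq_scalars hp, Mackey.disjoint_scalars_sl hp, (Mackey.soc_one hp).symm,
    fun z _ b b' => Mackey.slExt_eq hp z b b', fun z _ b => ?_, Mackey.glMFilt_zero hp,
    fun s hs => ?_, fun s hs => Mackey.disjoint_scalars_glMFilt hp (Mackey.aleph_le_mk hB hs),
    fun s hs => (Mackey.soc_succ_succ hp hB hs).symm, Mackey.isIdeal_le_glMFilt_iff hp hB,
    Mackey.isIdeal_glMFilt_lt_iff hp hB⟩
  · rw [Mackey.soc_succ_succ hp hB (Nat.zero_le t), Mackey.glMFilt_zero hp]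
    exact Mackey.slExt_le z b
  · rw [Mackey.soc_succ_succ hp hB hs]
    exact le_sup_right
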